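/- Let $(\Sigma,\mathbf p)$ be a probability space and let $T_{\lambda,\sigma}\in \mathrm{SL}(2,\mathbb R)$, $\lambda\in\mathbb R$, $\sigma\in\Sigma$, be measurable in $\sigma$ and smooth in $\lambda$. Assume that (as is the case when $\mathbf p$ has compact support and the $\lambda$-derivatives are jointly continuous) for all $k\in\mathbb N_0$ and $R>0$ there is a constant bounding the entries of $\partial_\lambda^kT_{\lambda,\sigma}$ for $|\lambda|\le R$ and $\mathbf p$-almost all $\sigma$. Write $\mathbf E$ for expectation, the $\sigma_n$ being independent with law $\mathbf p$. Let $\lambda=0$ be an anomaly of first order, i.e. $T_{0,\sigma}=\pm\mathbf 1$ for all $\sigma$, with a sign that may depend on $\sigma$. For $M\in \mathrm{SL}(2,\mathbb R)$ let $P_\sigma=P_\sigma^M$ be the matrix in $MT_{\lambda,\sigma}M^{-1}=\pm\exp(\lambda P_\sigma+\lambda^2Q_\sigma+O(\lambda^3))$, that is $P_\sigma=\pm M(\partial_\lambda T_{\lambda,\sigma}|_{\lambda=0})M^{-1}$ with the sign of $T_{0,\sigma}$. Suppose that the anomaly is of first degree and hyperbolic: $\mathbf E(P_\sigma)\neq0$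 and $\det\mathbf E(P_\sigma)<0$ (this does not depend on $M$). Then: 1. There are $M\in \mathrm{SL}(2,\mathbb R)$ and $\mu>0$ with $\mathbf E(P_\sigma)=\mathrm{diag}(\mu/2,-\mu/2)$. 2. Let $M\in \mathrm{SL}(2,\mathbb R)$ and $\mu\in\mathbb R$ be any pair with $\mathbf E(P_\sigma)=\mathrm{diag}(\mu/2,-\mu/2)$. With $v=\frac1{\sqrt2}\binom{1}{-\imath}$, $\alpha_\sigma=\langle v|P_\sigma|v\rangle$ and $\beta_\sigma=\langle\overline v|P_\sigma|v\rangle$, put $r_\sigma(\theta)=\Im m\bigl(\alpha_\sigma-(\beta_\sigma-\tfrac\mu2)e^{2\imath\theta}\bigr)$. If it is not the case that $r_\sigma(\pi/2)=0$ for $\mathbf p$-almost all $\sigma$, then for all sufficiently small $\lambda$ with $\lambda\mu>0$ the Lyapunov exponent $$\gamma(\lambda)=\lim_{N\to\infty}\frac1N\,\mathbf E\log\bigl\|T_{\lambda,\sigma_N}\cdots T_{\lambda,\sigma_1}e_\theta\bigr\|,\qquad e_\theta=\binom{\cos\theta}{\sin\theta},$$ exists for every initial angle $\theta$, does not depend on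 $\theta$, and $$\gamma(\lambda)=\tfrac12|\lambda\mu|+O(|\lambda|^{3/2})\qquad(\lambda\to0,\ \lambda\mu>0).$$ If it is not the case that $r_\sigma(0)=0$ for $\mathbf p$-almost all $\sigma$, then the same holds for $\lambda\to0$ with $\lambda\mu<0$. -/

import Mathlib

open MeasureTheory Filter Topology
open scoped ContDiff MatrixGroups

/-- Standing assumptions on a random family `T l σ` of matrices in `SL(2, ℝ)`, indexed by the
coupling constant `l` and a random variable `σ` with law `p`: measurable in `σ`, smooth in `l`, and,
as `p` has compact support, every derivative in `l` is bounded, uniformly for `l` in bounded sets and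
for `p`-almost all `σ`. (If `p` is carried by a compact subset of a topological space on which all
derivatives in `l` are jointly continuous in `(l, σ)`, then the last condition holds.) -/
structure IsSmoothRandomFamily {Ω : Type*} [MeasurableSpace Ω] (p : Measure Ω)
    (T : ℝ → Ω → SL(2, ℝ)) : Prop where
  measurable : ∀ (l : ℝ) (i j : Fin 2), Measurable fun σ => T l σ i j
  smooth : ∀ (σ : Ω) (i j : Fin 2), ContDiff ℝ ∞ fun l => T l σ i j
  bounded : ∀ (k : ℕ) (R : ℝ), ∃ C : ℝ, ∀ᵐ σ ∂p, ∀ l : ℝ, |l| ≤ R → ∀ i j : Fin 2,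
    |iteratedDeriv k (fun t => T t σ i j) l| ≤ C

/-- `l = 0` is an anomaly of first order: `T 0 σ = ± 1`, with a sign that may depend on `σ`. -/
def IsFirstOrderAnomaly {Ω : Type*} (T : ℝ → Ω → SL(2, ℝ)) : Prop :=
  ∀ σ, (T 0 σ : Matrix (Fin 2) (Fin 2) ℝ) = 1 ∨ (T 0 σ : Matrix (Fin 2) (Fin 2) ℝ) = -1

/-- The derivative in `l` of `T l σ` at `l = 0`. -/
noncomputable def derivAtZero {Ω : Type*} (T : ℝ → Ω → SL(2, ℝ)) (σ : Ω) :
    Matrix (Fin 2) (Fin 2) ℝ :=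
  Matrix.of fun i j => deriv (fun l => T l σ i j) 0

/-- The matrix `P_σ` of the expansion `M T_{l,σ} M⁻¹ = ± exp (l P_σ + l² Q_σ + O(l³))`, whose sign is
that of `T_{0,σ} = ± 1`. Differentiating at `l = 0` gives `P_σ = ± M (∂ T_{l,σ}|_{l=0}) M⁻¹`,
and the sign is kept track of by the factor `(T_{0,σ})⁻¹ = ± 1`. -/
noncomputable def firstOrderP {Ω : Type*} (T : ℝ → Ω → SL(2, ℝ)) (M : SL(2, ℝ)) (σ : Ω) :
    Matrix (Fin 2) (Fin 2) ℝ :=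
  (M : Matrix (Fin 2) (Fin 2) ℝ) *
    (((T 0 σ)⁻¹ : SL(2, ℝ)) : Matrix (Fin 2) (Fin 2) ℝ) * derivAtZero T σ *
      ((M⁻¹ : SL(2, ℝ)) : Matrix (Fin 2) (Fin 2) ℝ)

/-- The expectation `E(P_σ)`, taken entry by entry. -/
noncomputable def meanP {Ω : Type*} [MeasurableSpace Ω] (p : Measure Ω) (T : ℝ → Ω → SL(2, ℝ))
    (M : SL(2, ℝ)) : Matrix (Fin 2) (Fin 2) ℝ :=
  Matrix.of fun i j => ∫ σ, firstOrderP T M σ i j ∂p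

/-- A hyperbolic anomaly of first order and first degree: `E(P_σ)` does not vanish and has negative
determinant. These conditions do not depend on the basis change, so we take the trivial one. -/
structure IsHyperbolicFirstDegreeAnomaly {Ω : Type*} [MeasurableSpace Ω] (p : Measure Ω)
    (T : ℝ → Ω → SL(2, ℝ)) : Prop where
  firstOrder : IsFirstOrderAnomaly T
  firstDegree : meanP p T 1 ≠ 0
  hyperbolic : (meanP p T 1).det < 0

/-- The vector `v = (1, -i) / √2`. -/
noncomputable def vVec : Fin 2 → ℂ :=
  ![1 / (Real.sqrt 2 : ℂ), -Complex.I / (Real.sqrt 2 : ℂ)]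

/-- `α = ⟨v|P|v⟩`. -/
noncomputable def alphaCoeff (P : Matrix (Fin 2) (Fin 2) ℝ) : ℂ :=
  dotProduct (star vVec) ((P.map Complex.ofReal).mulVec vVec)

/-- `β = ⟨v̄|P|v⟩`, where the bra of `v̄` is the row vector `v`. -/
noncomputable def betaCoeff (P : Matrix (Fin 2) (Fin 2) ℝ) : ℂ :=
  dotProduct vVec ((P.map Complex.ofReal).mulVec vVec)

/-- The centered perturbation `r_σ(θ) = Im (α_σ - (β_σ - μ/2) e^{2iθ})`. -/
noncomputable def centeredPerturbation {Ω : Type*} (T : ℝ → Ω → SL(2, ℝ)) (M : SL(2, ℝ)) (μ : ℝ)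
    (σ : Ω) (θ : ℝ) : ℝ :=
  (alphaCoeff (firstOrderP T M σ) -
    (betaCoeff (firstOrderP T M σ) - (μ : ℂ) / 2) * Complex.exp (2 * Complex.I * (θ : ℂ))).im

/-- The product `T_{l,w(N-1)} ⋯ T_{l,w(0)}` along a code `w`. -/
def transferProduct {Ω : Type*} (T : ℝ → Ω → SL(2, ℝ)) (l : ℝ) (w : ℕ → Ω) : ℕ → SL(2, ℝ)
  | 0 => 1
  | N + 1 => T l (w N) * transferProduct T l w N

/-- `log ‖T_{l,w(N-1)} ⋯ T_{l,w(0)} e_θ‖` with `e_θ = (cos θ, sin θ)` and the Euclidean norm. -/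
noncomputable def logGrowth {Ω : Type*} (T : ℝ → Ω → SL(2, ℝ)) (l θ : ℝ) (N : ℕ) (w : ℕ → Ω) : ℝ :=
  Real.log ‖WithLp.toLp 2
    ((transferProduct T l w N : Matrix (Fin 2) (Fin 2) ℝ).mulVec ![Real.cos θ, Real.sin θ])‖

/-- `γ` is the Lyapunov exponent at `l`: for independent `σ_n` with law `p` and for every initial
angle `θ`, the limit of `N⁻¹ E log ‖T_{l,σ_N} ⋯ T_{l,σ_1} e_θ‖` exists and is `γ`. -/
def HasLyapunovExponent {Ω : Type*} [MeasurableSpace Ω] (p : Measure Ω) [IsProbabilityMeasure p]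
    (T : ℝ → Ω → SL(2, ℝ)) (l γ : ℝ) : Prop :=
  ∀ θ : ℝ,
    (∀ N : ℕ, Integrable (logGrowth T l θ N) (Measure.infinitePi fun _ : ℕ => p)) ∧
    Tendsto (fun N : ℕ =>
      (1 / (N : ℝ)) * ∫ w, logGrowth T l θ N w ∂(Measure.infinitePi fun _ : ℕ => p)) atTop (𝓝 γ)

/-! Write η = √|λ| and let λμ > 0. In the basis `M` the averaged dynamics expands the first axis and
contracts the second, both at rate |λμ|/2. The theorem follows by trapping the mean one-step
increment of functions at bounded distance from the log-norm, uniformly in the direction.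

Upper bound: at the unit direction z the mean increment of log‖My‖ is (|λμ|/2)(z₁² - z₂²) + O(λ²),
which is at most |λμ|/2 + O(λ²).

Lower bound: the obstacle is the second axis, along which the averaged dynamics shrinks vectors.
Only noise drives a direction away from it, through the entry `P 0 1`, which is r_σ(π/2) up to sign.
Diffusion and drift balance where the first coordinate is of order η times the second, so the second
coordinate is multiplied by kη. A step then reads 1 + ηaN + η²·diagonal + O(η³), with N nilpotent
and a = ±`P 0 1`/k centered: the variance of a enters at order η², like the drift. The function
`adaptedLog`, the logarithm of the rescaled norm minus a bounded correction, then gains on average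
at least |λμ|/2 - O(η³) from every direction (`exists_adaptedLog_step`, `one_le_drift_polynomial`).
The error η³ is the |λ|^{3/2} of the theorem.

Existence of the limit: a function F with mean increments at least c > 0 also yields contraction. As
|det(x, y)| is invariant under SL(2, ℝ), the quantity D = |det(x, y)|^α exp(-α(F x + F y)) shrinks
on average by the factor 1 - αc when α is small. The iterated transfer operator therefore flattens
the mean increment of the log-norm to a constant geometrically fast, and that constant is γ
(`exists_tendsto_growth`). No invariant measure is needed.

The case λμ < 0 reduces to λμ > 0 by a quarter turn, which exchanges the axes. The normal form of
E(P) exists because P is traceless, as the derivative of a path of determinant one. -/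

/-- The orbit `x, act (w 0) x, act (w 1) (act (w 0) x), …` of `x` along the code `w`. -/
def randomOrbit {Ω X : Type*} (act : Ω → X → X) (x : X) (w : ℕ → Ω) : ℕ → X
  | 0 => x
  | N + 1 => act (w N) (randomOrbit act x w N)

/-- The transfer operator `f ↦ (x ↦ E f(act σ x))` of a random map. -/
noncomputable def transferOp {Ω X : Type*} [MeasurableSpace Ω] (p : Measure Ω) (act : Ω → X → X)
    (f : X → ℝ) (x : X) : ℝ :=
  ∫ σ, f (act σ x) ∂p

/-! ### Random maps: Markov property, drift and contraction -/

section RandomMaps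

variable {Ω X : Type*} [MeasurableSpace Ω] [MeasurableSpace X] {p : Measure Ω}
  [IsProbabilityMeasure p] {act : Ω → X → X}

/-- The orbit at time N reads only the letters with index strictly below N; this is what makes it
independent of `w N`. -/
lemma measurable_randomOrbit_past (hact : Measurable (Function.uncurry act)) (x : X) (N : ℕ) :
    Measurable[⨆ i ∈ Set.Iio N, MeasurableSpace.comap (fun w : ℕ → Ω => w i) inferInstance]
      (fun w : ℕ → Ω => randomOrbit act x w N) := by
  induction N with
  | zero => exact measurable_const
  | succ N ih =>
    have h1 : Measurable[⨆ i ∈ Set.Iio (N + 1),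
        MeasurableSpace.comap (fun w : ℕ → Ω => w i) inferInstance] (fun w : ℕ → Ω => w N) := by
      refine Measurable.mono (comap_measurable _) ?_ le_rfl
      exact le_iSup₂_of_le N (Nat.lt_succ_self N) le_rfl
    have h2 := ih.mono (biSup_mono (fun i (hi : i < N) => Nat.lt_succ_of_lt hi) :
      (⨆ i ∈ Set.Iio N, MeasurableSpace.comap (fun w : ℕ → Ω => w i) inferInstance) ≤ _) le_rfl
    exact hact.comp (h1.prodMk h2)

lemma iSup_comap_eval_le (S : Set ℕ) :
    (⨆ i ∈ S, MeasurableSpace.comap (fun w : ℕ → Ω => w i) inferInstance) ≤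
      (MeasurableSpace.pi : MeasurableSpace (ℕ → Ω)) :=
  iSup₂_le fun i _ => (measurable_pi_apply i).comap_le

lemma measurable_randomOrbit (hact : Measurable (Function.uncurry act)) (x : X) (N : ℕ) :
    Measurable (fun w : ℕ → Ω => randomOrbit act x w N) :=
  (measurable_randomOrbit_past hact x N).mono (iSup_comap_eval_le _) le_rfl

lemma map_eval_randomOrbit (hact : Measurable (Function.uncurry act)) (x : X) (N : ℕ) :
    (Measure.infinitePi fun _ : ℕ => p).map (fun w => (w N, randomOrbit act x w N)) =
      p.prod ((Measure.infinitePi fun _ : ℕ => p).map (fun w => randomOrbit act x w N)) := by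
  have hind : ProbabilityTheory.IndepFun (fun w : ℕ → Ω => w N)
      (fun w : ℕ → Ω => randomOrbit act x w N) (Measure.infinitePi fun _ : ℕ => p) := by
    have h1 := ProbabilityTheory.iIndepFun_infinitePi (P := fun _ : ℕ => p)
      (X := fun _ => (id : Ω → Ω)) (fun _ => measurable_id)
    have h2 := ProbabilityTheory.indep_iSup_of_disjoint
      (fun i => (measurable_pi_apply i).comap_le) h1.iIndep
      (S := {N}) (T := Set.Iio N) (by simp)
    refine ProbabilityTheory.indep_of_indep_of_le_right
      (ProbabilityTheory.indep_of_indep_of_le_left h2 ?_) ?_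
    · exact le_iSup₂_of_le N rfl le_rfl
    · exact (measurable_randomOrbit_past hact x N).comap_le
  rw [hind.map_prod_eq_prod_map_map (measurable_pi_apply N).aemeasurable
    (measurable_randomOrbit hact x N).aemeasurable]
  rw [Measure.infinitePi_map_eval (fun _ : ℕ => p) N]

lemma integral_eval_randomOrbit (hact : Measurable (Function.uncurry act)) (x : X) (N : ℕ)
    {g : Ω → X → ℝ} (hg : Measurable (Function.uncurry g)) {L : ℝ}
    (hb : ∀ᵐ σ ∂p, ∀ y, |g σ y| ≤ L) :
    Integrable (fun w => g (w N) (randomOrbit act x w N)) (Measure.infinitePi fun _ : ℕ => p) ∧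
    ∫ w, g (w N) (randomOrbit act x w N) ∂(Measure.infinitePi fun _ : ℕ => p) =
      ∫ w, (∫ σ, g σ (randomOrbit act x w N) ∂p) ∂(Measure.infinitePi fun _ : ℕ => p) := by
  have hm := measurable_randomOrbit hact x N
  have hm2 : Measurable (fun w : ℕ → Ω => (w N, randomOrbit act x w N)) :=
    (measurable_pi_apply N).prodMk hm
  have : IsProbabilityMeasure
      ((Measure.infinitePi fun _ : ℕ => p).map (fun w => randomOrbit act x w N)) :=
    Measure.isProbabilityMeasure_map hm.aemeasurable
  have hbound : ∀ᵐ z ∂(p.prod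
      ((Measure.infinitePi fun _ : ℕ => p).map (fun w => randomOrbit act x w N))),
      ‖Function.uncurry g z‖ ≤ L := by
    have := Measure.quasiMeasurePreserving_fst (μ := p)
      (ν := (Measure.infinitePi fun _ : ℕ => p).map (fun w => randomOrbit act x w N))
    filter_upwards [this.ae hb] with z hz
    exact hz z.2
  have hint : Integrable (Function.uncurry g) (p.prod
      ((Measure.infinitePi fun _ : ℕ => p).map (fun w => randomOrbit act x w N))) :=
    Integrable.of_bound hg.aestronglyMeasurable L hbound
  constructor
  · have := hint
    rw [← map_eval_randomOrbit hact x N] at this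
    exact this.comp_measurable hm2
  · calc ∫ w, g (w N) (randomOrbit act x w N) ∂(Measure.infinitePi fun _ : ℕ => p)
        = ∫ z, Function.uncurry g z ∂((Measure.infinitePi fun _ : ℕ => p).map
            (fun w => (w N, randomOrbit act x w N))) :=
          (integral_map hm2.aemeasurable hg.aestronglyMeasurable).symm
      _ = ∫ y, (∫ σ, g σ y ∂p) ∂((Measure.infinitePi fun _ : ℕ => p).map
            (fun w => randomOrbit act x w N)) := by
          rw [map_eval_randomOrbit hact x N, integral_prod_symm _ hint]
          rfl
      _ = _ := by
          refine integral_map hm.aemeasurable ?_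
          exact (hg.stronglyMeasurable.integral_prod_left'
            (f := Function.uncurry g)).aestronglyMeasurable

lemma measurable_transferOp (hact : Measurable (Function.uncurry act)) {f : X → ℝ}
    (hf : Measurable f) : Measurable (transferOp p act f) :=
  (StronglyMeasurable.integral_prod_left' (μ := p) (f := fun z : Ω × X => f (act z.1 z.2))
    (hf.comp hact).stronglyMeasurable).measurable

lemma abs_integral_le_of_ae_bound {f : Ω → ℝ} {B : ℝ} (hB : ∀ᵐ σ ∂p, |f σ| ≤ B) :
    |∫ σ, f σ ∂p| ≤ B := by
  have := norm_integral_le_of_norm_le_const (μ := p) (f := f) (C := B) hB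
  simpa using this

/-- Markov property. The last letter is averaged out first, which replaces f by its image under the
transfer operator; hence the induction runs over all bounded f. -/
lemma integral_randomOrbit_eq_iterate (hact : Measurable (Function.uncurry act)) (x : X) (N : ℕ)
    {f : X → ℝ} (hf : Measurable f) {B : ℝ} (hB : ∀ y, |f y| ≤ B) :
    ∫ w, f (randomOrbit act x w N) ∂(Measure.infinitePi fun _ : ℕ => p) =
      (transferOp p act)^[N] f x := by
  induction N generalizing f with
  | zero => simp [randomOrbit]
  | succ N ih =>
    rw [Function.iterate_succ_apply]
    rw [← ih (measurable_transferOp hact hf)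
      (fun y => abs_integral_le_of_ae_bound (ae_of_all _ fun σ => hB _))]
    exact (integral_eval_randomOrbit hact x N (g := fun σ y => f (act σ y)) (hf.comp hact)
      (ae_of_all _ fun σ y => hB _)).2

/-- The mean increment `E (f(act σ x) - f x)`. -/
noncomputable def meanIncrement (p : Measure Ω) (act : Ω → X → X) (f : X → ℝ) (x : X) : ℝ :=
  ∫ σ, (f (act σ x) - f x) ∂p

lemma measurable_increment (hact : Measurable (Function.uncurry act)) {f : X → ℝ}
    (hf : Measurable f) : Measurable (Function.uncurry fun σ y => f (act σ y) - f y) :=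
  (hf.comp hact).sub (hf.comp measurable_snd)

lemma measurable_meanIncrement (hact : Measurable (Function.uncurry act)) {f : X → ℝ}
    (hf : Measurable f) : Measurable (meanIncrement p act f) :=
  (StronglyMeasurable.integral_prod_left' (μ := p)
    (measurable_increment hact hf).stronglyMeasurable).measurable

lemma integrable_randomOrbit (hact : Measurable (Function.uncurry act)) (x : X) {f : X → ℝ}
    (hf : Measurable f) {L : ℝ} (hL : ∀ᵐ σ ∂p, ∀ y, |f (act σ y) - f y| ≤ L) (N : ℕ) :
    Integrable (fun w => f (randomOrbit act x w N)) (Measure.infinitePi fun _ : ℕ => p) := by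
  induction N with
  | zero => simp [randomOrbit]
  | succ N ih =>
    have h := (integral_eval_randomOrbit hact x N (measurable_increment hact hf) hL).1.add ih
    refine h.congr (ae_of_all _ fun w => ?_)
    simp [randomOrbit]

lemma integral_randomOrbit_succ (hact : Measurable (Function.uncurry act)) (x : X) {f : X → ℝ}
    (hf : Measurable f) {L : ℝ} (hL : ∀ᵐ σ ∂p, ∀ y, |f (act σ y) - f y| ≤ L) (N : ℕ) :
    ∫ w, f (randomOrbit act x w (N + 1)) ∂(Measure.infinitePi fun _ : ℕ => p) =
      ∫ w, f (randomOrbit act x w N) ∂(Measure.infinitePi fun _ : ℕ => p) +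
      ∫ w, meanIncrement p act f (randomOrbit act x w N)
        ∂(Measure.infinitePi fun _ : ℕ => p) := by
  have h := integral_eval_randomOrbit hact x N (measurable_increment hact hf) hL
  have h0 := integrable_randomOrbit hact x hf hL N
  have h1 : ∫ w, f (randomOrbit act x w (N + 1)) ∂(Measure.infinitePi fun _ : ℕ => p) =
      ∫ w, (f (randomOrbit act x w N) + (f (act (w N) (randomOrbit act x w N)) -
        f (randomOrbit act x w N))) ∂(Measure.infinitePi fun _ : ℕ => p) := by
    congr 1; ext w; simp [randomOrbit]
  rw [h1, integral_add h0 h.1, h.2]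
  rfl

lemma le_integral_randomOrbit (hact : Measurable (Function.uncurry act)) (x : X) {f : X → ℝ}
    (hf : Measurable f) {L : ℝ} (hL : ∀ᵐ σ ∂p, ∀ y, |f (act σ y) - f y| ≤ L) {c : ℝ}
    (hc : ∀ y, c ≤ meanIncrement p act f y) (N : ℕ) :
    f x + N * c ≤ ∫ w, f (randomOrbit act x w N) ∂(Measure.infinitePi fun _ : ℕ => p) := by
  induction N with
  | zero => simp [randomOrbit]
  | succ N ih =>
    rw [integral_randomOrbit_succ hact x hf hL]
    have : c ≤ ∫ w, meanIncrement p act f (randomOrbit act x w N)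
        ∂(Measure.infinitePi fun _ : ℕ => p) := by
      have hi : Integrable (fun w => meanIncrement p act f (randomOrbit act x w N))
          (Measure.infinitePi fun _ : ℕ => p) := by
        refine Integrable.of_bound ((measurable_meanIncrement hact hf).comp
          (measurable_randomOrbit hact x N)).aestronglyMeasurable L (ae_of_all _ fun w => ?_)
        exact abs_integral_le_of_ae_bound (hL.mono fun σ h => h _)
      calc c = ∫ _w, c ∂(Measure.infinitePi fun _ : ℕ => p) := by simp
        _ ≤ _ := integral_mono (integrable_const _) hi fun w => hc _
    push_cast
    linarith

/-- A linear lower bound on the mean of `F` passes to the growth rate of any `ψ` at bounded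
distance from `F`. -/
lemma le_of_tendsto_growth (hact : Measurable (Function.uncurry act)) (x : X) {f ψ : X → ℝ}
    (hf : Measurable f) {L : ℝ} (hL : ∀ᵐ σ ∂p, ∀ y, |f (act σ y) - f y| ≤ L) {c : ℝ}
    (hc : ∀ y, c ≤ meanIncrement p act f y) {K : ℝ} (hK : ∀ y, |f y - ψ y| ≤ K)
    (hψ : ∀ N, Integrable (fun w => ψ (randomOrbit act x w N))
      (Measure.infinitePi fun _ : ℕ => p)) {γ : ℝ}
    (hγ : Tendsto (fun N : ℕ => (1 / (N : ℝ)) *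
      ∫ w, ψ (randomOrbit act x w N) ∂(Measure.infinitePi fun _ : ℕ => p)) atTop (𝓝 γ)) :
    c ≤ γ := by
  have h1 : ∀ N : ℕ, f x + N * c - K ≤
      ∫ w, ψ (randomOrbit act x w N) ∂(Measure.infinitePi fun _ : ℕ => p) := fun N => by
    have h2 := le_integral_randomOrbit hact x hf hL hc N
    have h3 : ∫ w, (f (randomOrbit act x w N) - K) ∂(Measure.infinitePi fun _ : ℕ => p) ≤
        ∫ w, ψ (randomOrbit act x w N) ∂(Measure.infinitePi fun _ : ℕ => p) := by
      refine integral_mono ((integrable_randomOrbit hact x hf hL N).sub (integrable_const _))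
        (hψ N) fun w => ?_
      have := (abs_le.1 (hK (randomOrbit act x w N))).2
      simp only; linarith
    rw [integral_sub (integrable_randomOrbit hact x hf hL N) (integrable_const _)] at h3
    simp at h3
    linarith
  have h4 : Tendsto (fun N : ℕ => (1 / (N : ℝ)) * (f x - K) + c) atTop (𝓝 (0 * (f x - K) + c)) :=
    (tendsto_one_div_atTop_nhds_zero_nat.mul_const _).add_const _
  rw [zero_mul, zero_add] at h4
  refine le_of_tendsto_of_tendsto h4 hγ ?_
  filter_upwards [eventually_gt_atTop 0] with N hN
  have hN' : (0 : ℝ) < N := by exact_mod_cast hN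
  have := mul_le_mul_of_nonneg_left (h1 N) (one_div_nonneg.2 hN'.le)
  refine le_trans (le_of_eq ?_) this
  field_simp
  ring

/-- Contraction of the transfer operator in the Hölder-type semimetric `D`. -/
lemma abs_iterate_transferOp_sub_le (hact : Measurable (Function.uncurry act)) {φ : X → ℝ}
    (hφ : Measurable φ) {B : ℝ} (hB : ∀ y, |φ y| ≤ B) {D : X → X → ℝ} {C ρ : ℝ} (hC : 0 ≤ C)
    (hρ : 0 ≤ ρ)
    (hφD : ∀ x y, |φ x - φ y| ≤ C * D x y)
    (hDi : ∀ x y, Integrable (fun σ => D (act σ x) (act σ y)) p)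
    (hD : ∀ x y, ∫ σ, D (act σ x) (act σ y) ∂p ≤ ρ * D x y) (N : ℕ) :
    Measurable ((transferOp p act)^[N] φ) ∧ (∀ y, |(transferOp p act)^[N] φ y| ≤ B) ∧
    ∀ x y, |(transferOp p act)^[N] φ x - (transferOp p act)^[N] φ y| ≤ C * ρ ^ N * D x y := by
  induction N with
  | zero => simpa using ⟨hφ, hB, hφD⟩
  | succ N ih =>
    obtain ⟨h1, h2, h3⟩ := ih
    rw [Function.iterate_succ_apply']
    refine ⟨measurable_transferOp hact h1,
      fun y => abs_integral_le_of_ae_bound (ae_of_all _ fun σ => h2 _), fun x y => ?_⟩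
    have hi : ∀ x, Integrable (fun σ => (transferOp p act)^[N] φ (act σ x)) p := fun x =>
      Integrable.of_bound (h1.comp (hact.comp
        (measurable_id.prodMk measurable_const))).aestronglyMeasurable B
        (ae_of_all _ fun σ => h2 _)
    unfold transferOp at hi ⊢
    rw [← integral_sub (hi x) (hi y)]
    calc _ ≤ ∫ σ, |(transferOp p act)^[N] φ (act σ x) - (transferOp p act)^[N] φ (act σ y)| ∂p :=
          abs_integral_le_integral_abs
      _ ≤ ∫ σ, C * ρ ^ N * D (act σ x) (act σ y) ∂p :=
          integral_mono ((hi x).sub (hi y)).abs ((hDi x y).const_mul _) fun σ => h3 _ _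
      _ = C * ρ ^ N * ∫ σ, D (act σ x) (act σ y) ∂p := integral_const_mul _ _
      _ ≤ C * ρ ^ N * (ρ * D x y) := by gcongr; exact hD x y
      _ = _ := by ring

/-- The mean of ψ along the orbit is ψ x plus the sum of the iterates of the transfer operator on
the mean increment φ. One more application of the operator averages the current iterate, so it moves
values by at most the oscillation, which decays like ρ ^ N. The iterates converge to a common
constant, and Cesàro means finish. -/
lemma exists_tendsto_growth_of_contraction [Nonempty X] (hact : Measurable (Function.uncurry act))
    {ψ : X → ℝ} (hψ : Measurable ψ) {L : ℝ} (hL : ∀ᵐ σ ∂p, ∀ y, |ψ (act σ y) - ψ y| ≤ L)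
    {D : X → X → ℝ} {C ρ R : ℝ} (hC : 0 ≤ C) (hρ : 0 ≤ ρ) (hρ1 : ρ < 1)
    (hDR : ∀ x y, D x y ≤ R)
    (hφD : ∀ x y, |meanIncrement p act ψ x - meanIncrement p act ψ y| ≤ C * D x y)
    (hDi : ∀ x y, Integrable (fun σ => D (act σ x) (act σ y)) p)
    (hD : ∀ x y, ∫ σ, D (act σ x) (act σ y) ∂p ≤ ρ * D x y) :
    ∃ γ : ℝ, ∀ x, Tendsto (fun N : ℕ => (1 / (N : ℝ)) *
      ∫ w, ψ (randomOrbit act x w N) ∂(Measure.infinitePi fun _ : ℕ => p)) atTop (𝓝 γ) := by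
  set φ := meanIncrement p act ψ with hφdef
  have hφ : Measurable φ := measurable_meanIncrement hact hψ
  have hB : ∀ y, |φ y| ≤ L := fun y => abs_integral_le_of_ae_bound (hL.mono fun σ h => h _)
  have key := abs_iterate_transferOp_sub_le hact hφ hB hC hρ hφD hDi hD
  have hosc : ∀ N x y, |(transferOp p act)^[N] φ x - (transferOp p act)^[N] φ y| ≤
      C * R * ρ ^ N := fun N x y => by
    refine ((key N).2.2 x y).trans ?_
    have := mul_le_mul_of_nonneg_left (hDR x y) (mul_nonneg hC (pow_nonneg hρ N))
    linarith
  have hi : ∀ N x, Integrable (fun σ => (transferOp p act)^[N] φ (act σ x)) p := fun N x =>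
    Integrable.of_bound ((key N).1.comp (hact.comp
      (measurable_id.prodMk measurable_const))).aestronglyMeasurable L
      (ae_of_all _ fun σ => (key N).2.1 _)
  have hstep : ∀ x N, dist ((transferOp p act)^[N] φ x) ((transferOp p act)^[N + 1] φ x) ≤
      C * R * ρ ^ N := fun x N => by
    rw [Function.iterate_succ_apply', Real.dist_eq]
    have h1 : (transferOp p act)^[N] φ x = ∫ _σ, (transferOp p act)^[N] φ x ∂p := by simp
    have h2 : (transferOp p act)^[N] φ x - transferOp p act ((transferOp p act)^[N] φ) x =
        ∫ σ, ((transferOp p act)^[N] φ x - (transferOp p act)^[N] φ (act σ x)) ∂p := by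
      rw [integral_sub (integrable_const _) (hi N x), ← h1]; rfl
    rw [h2]
    exact abs_integral_le_of_ae_bound (ae_of_all _ fun σ => hosc N _ _)
  have hlim : ∀ x, ∃ γ, Tendsto (fun N => (transferOp p act)^[N] φ x) atTop (𝓝 γ) := fun x =>
    cauchySeq_tendsto_of_complete (cauchySeq_of_le_geometric ρ (C * R) hρ1 (hstep x))
  obtain ⟨x₀⟩ := ‹Nonempty X›
  obtain ⟨γ, hγ⟩ := hlim x₀
  refine ⟨γ, fun x => ?_⟩
  have hx : Tendsto (fun N => (transferOp p act)^[N] φ x) atTop (𝓝 γ) := by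
    have hz : Tendsto (fun N : ℕ => C * R * ρ ^ N) atTop (𝓝 0) := by
      simpa using (tendsto_pow_atTop_nhds_zero_of_lt_one hρ hρ1).const_mul (C * R)
    have hd := squeeze_zero_norm
      (f := fun N => (transferOp p act)^[N] φ x - (transferOp p act)^[N] φ x₀)
      (fun N => hosc N x x₀) hz
    simpa using hd.add hγ
  have hsum : ∀ N : ℕ, ∫ w, ψ (randomOrbit act x w N) ∂(Measure.infinitePi fun _ : ℕ => p) =
      ψ x + ∑ k ∈ Finset.range N, (transferOp p act)^[k] φ x := fun N => by
    induction N with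
    | zero => simp [randomOrbit]
    | succ N ih =>
      rw [integral_randomOrbit_succ hact x hψ hL, ih, Finset.sum_range_succ,
        ← integral_randomOrbit_eq_iterate hact x N hφ hB, add_assoc]
  have h0 : Tendsto (fun N : ℕ => (1 / (N : ℝ)) * ψ x) atTop (𝓝 (0 * ψ x)) :=
    tendsto_one_div_atTop_nhds_zero_nat.mul_const _
  have := h0.add hx.cesaro
  rw [zero_mul, zero_add] at this
  refine this.congr fun N => ?_
  rw [hsum, one_div, mul_add]

lemma exp_neg_le_one_sub_add_sq {t : ℝ} (ht : |t| ≤ 1) : Real.exp (-t) ≤ 1 - t + t ^ 2 := by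
  have h := (abs_le.1 (Real.abs_exp_sub_one_sub_id_le (x := -t) (by simpa using ht))).2
  nlinarith

/-- A random map that preserves `d`, with a Lyapunov function `F` of positive drift at bounded
distance from `ψ`, has a growth rate for `ψ` that does not depend on the initial point. -/
theorem exists_tendsto_growth [Nonempty X] (hact : Measurable (Function.uncurry act))
    {ψ : X → ℝ} (hψ : Measurable ψ) {L : ℝ} (hL : ∀ᵐ σ ∂p, ∀ y, |ψ (act σ y) - ψ y| ≤ L)
    {F : X → ℝ} (hF : Measurable F) {K : ℝ} (hK : ∀ y, |F y - ψ y| ≤ K)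
    {c : ℝ} (hc : 0 < c) (hdrift : ∀ y, c ≤ meanIncrement p act F y)
    {d : X → X → ℝ} (hd0 : ∀ x y, 0 ≤ d x y) (hdinv : ∀ σ x y, d (act σ x) (act σ y) = d x y)
    (hd1 : ∀ x y, d x y * Real.exp (-(ψ x + ψ y)) ≤ 1)
    {C : ℝ} (hC : 0 ≤ C)
    (hLip : ∀ᵐ σ ∂p, ∀ x y, |(ψ (act σ x) - ψ x) - (ψ (act σ y) - ψ y)| ≤
      C * (d x y * Real.exp (-(ψ x + ψ y)))) :
    ∃ γ : ℝ, ∀ x, Tendsto (fun N : ℕ => (1 / (N : ℝ)) *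
      ∫ w, ψ (randomOrbit act x w N) ∂(Measure.infinitePi fun _ : ℕ => p)) atTop (𝓝 γ) := by
  obtain ⟨x₀⟩ := id ‹Nonempty X›
  have hK0 : 0 ≤ K := (abs_nonneg _).trans (hK x₀)
  -- F is within K of ψ, so its increments are bounded by |L| + 2K; the extra 1 gives L' ≥ 1.
  obtain ⟨L', hL'⟩ : ∃ L', L' = |L| + 2 * K + 1 := ⟨_, rfl⟩
  have hL'1 : 1 ≤ L' := by have := abs_nonneg L; linarith
  have hFL : ∀ᵐ σ ∂p, ∀ y, |F (act σ y) - F y| ≤ L' := by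
    filter_upwards [hL] with σ h y
    have h1 := abs_le.1 (h y)
    have h2 := abs_le.1 (hK y)
    have h3 := abs_le.1 (hK (act σ y))
    have h4 := le_abs_self L
    exact abs_le.2 ⟨by linarith, by linarith⟩
  have hcL : c ≤ L' := (hdrift x₀).trans
    ((le_abs_self _).trans (abs_integral_le_of_ae_bound (hFL.mono fun σ h => h _)))
  -- With this α the quadratic error (2αL')² of the exponential equals αc. The linear term gains 2αc
  -- on average, so the contraction factor is 1 - αc.
  obtain ⟨α, hα⟩ : ∃ α, α = c / (4 * L' ^ 2) := ⟨_, rfl⟩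
  have hα0 : 0 < α := by rw [hα]; positivity
  have hαL : α * (4 * L' ^ 2) = c := by rw [hα]; field_simp
  have hαL1 : α * (4 * L') ≤ 1 := by
    by_contra! h
    nlinarith
  have hα1 : α ≤ 1 := by nlinarith
  have hαc : α * c ≤ 1 := by nlinarith
  have hFi : ∀ x, Integrable (fun σ => F (act σ x) - F x) p := fun x =>
    Integrable.of_bound ((hF.comp (hact.comp
      (measurable_id.prodMk measurable_const))).sub measurable_const).aestronglyMeasurable L'
      (hFL.mono fun σ h => h x)
  obtain ⟨D, hD⟩ : ∃ D : X → X → ℝ,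
      D = fun x y => d x y ^ α * Real.exp (-(α * (F x + F y))) := ⟨_, rfl⟩
  have hD0 : ∀ x y, 0 ≤ D x y := fun x y => by
    rw [hD]; exact mul_nonneg (Real.rpow_nonneg (hd0 x y) _) (Real.exp_pos _).le
  have hDψ : ∀ x y, (d x y * Real.exp (-(ψ x + ψ y))) ^ α =
      d x y ^ α * Real.exp (-(α * (ψ x + ψ y))) := fun x y => by
    rw [Real.mul_rpow (hd0 x y) (Real.exp_pos _).le, ← Real.exp_mul]
    congr 2; ring
  have hstep : ∀ σ x y, D (act σ x) (act σ y) =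
      D x y * Real.exp (-(α * ((F (act σ x) - F x) + (F (act σ y) - F y)))) := fun σ x y => by
    rw [hD]
    simp only [hdinv, mul_assoc, ← Real.exp_add]
    congr 2; ring
  have hsmall : ∀ᵐ σ ∂p, ∀ x y,
      |α * ((F (act σ x) - F x) + (F (act σ y) - F y))| ≤ α * (2 * L') := by
    filter_upwards [hFL] with σ h x y
    rw [abs_mul, abs_of_pos hα0]
    have h1 := abs_le.1 (h x)
    have h2 := abs_le.1 (h y)
    gcongr
    exact abs_le.2 ⟨by linarith, by linarith⟩
  have hexp : ∀ᵐ σ ∂p, ∀ x y, D (act σ x) (act σ y) ≤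
      D x y * (1 - α * ((F (act σ x) - F x) + (F (act σ y) - F y)) + α * c) := by
    filter_upwards [hsmall] with σ h x y
    rw [hstep]
    refine mul_le_mul_of_nonneg_left ?_ (hD0 x y)
    refine (exp_neg_le_one_sub_add_sq ((h x y).trans (by nlinarith))).trans ?_
    have h2 : (α * ((F (act σ x) - F x) + (F (act σ y) - F y))) ^ 2 ≤ (α * (2 * L')) ^ 2 :=
      sq_le_sq.2 ((h x y).trans (le_abs_self _))
    have h3 : (α * (2 * L')) ^ 2 = α * c := by rw [← hαL]; ring
    linarith
  have hmeas : ∀ x y, Measurable fun σ => D (act σ x) (act σ y) := fun x y => by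
    simp only [hD, hdinv]
    have h1 : ∀ z, Measurable fun σ => F (act σ z) := fun z =>
      hF.comp (hact.comp (measurable_id.prodMk measurable_const))
    exact ((((h1 x).add (h1 y)).const_mul α).neg.exp).const_mul _
  have hDi : ∀ x y, Integrable (fun σ => D (act σ x) (act σ y)) p := fun x y => by
    refine Integrable.of_bound (hmeas x y).aestronglyMeasurable
      (D x y * Real.exp (α * (2 * L'))) (hsmall.mono fun σ h => ?_)
    rw [hstep, Real.norm_eq_abs, abs_mul, abs_of_nonneg (hD0 x y), Real.abs_exp]
    refine mul_le_mul_of_nonneg_left (Real.exp_le_exp.2 ?_) (hD0 x y)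
    have := (abs_le.1 (h x y)).1
    linarith
  have hψF : ∀ x y, d x y ^ α * Real.exp (-(α * (ψ x + ψ y))) ≤
      Real.exp (α * (2 * K)) * D x y := fun x y => by
    rw [hD]
    have h1 : Real.exp (-(α * (ψ x + ψ y))) ≤
        Real.exp (α * (2 * K)) * Real.exp (-(α * (F x + F y))) := by
      rw [← Real.exp_add]
      refine Real.exp_le_exp.2 ?_
      have h2 := abs_le.1 (hK x)
      have h3 := abs_le.1 (hK y)
      nlinarith
    have := mul_le_mul_of_nonneg_left h1 (Real.rpow_nonneg (hd0 x y) α)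
    simp only
    linarith
  have hFψ : ∀ x y, D x y ≤
      Real.exp (α * (2 * K)) * (d x y ^ α * Real.exp (-(α * (ψ x + ψ y)))) := fun x y => by
    rw [hD]
    have h1 : Real.exp (-(α * (F x + F y))) ≤
        Real.exp (α * (2 * K)) * Real.exp (-(α * (ψ x + ψ y))) := by
      rw [← Real.exp_add]
      refine Real.exp_le_exp.2 ?_
      have h2 := abs_le.1 (hK x)
      have h3 := abs_le.1 (hK y)
      nlinarith
    have := mul_le_mul_of_nonneg_left h1 (Real.rpow_nonneg (hd0 x y) α)
    simp only
    linarith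
  have ht0 : ∀ x y, 0 ≤ d x y * Real.exp (-(ψ x + ψ y)) := fun x y =>
    mul_nonneg (hd0 x y) (Real.exp_pos _).le
  have hψi : ∀ x, Integrable (fun σ => ψ (act σ x) - ψ x) p := fun x =>
    Integrable.of_bound ((hψ.comp (hact.comp
      (measurable_id.prodMk measurable_const))).sub measurable_const).aestronglyMeasurable L
      (hL.mono fun σ h => h x)
  refine exists_tendsto_growth_of_contraction hact hψ hL (D := D)
    (C := C * Real.exp (α * (2 * K))) (ρ := 1 - α * c) (R := Real.exp (α * (2 * K)))
    (mul_nonneg hC (Real.exp_pos _).le) (by linarith) (by nlinarith) ?_ ?_ hDi ?_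
  · intro x y
    refine (hFψ x y).trans ?_
    rw [← hDψ]
    have := Real.rpow_le_one (ht0 x y) (hd1 x y) hα0.le
    nlinarith [Real.exp_pos (α * (2 * K))]
  · intro x y
    have h1 : |meanIncrement p act ψ x - meanIncrement p act ψ y| ≤
        C * (d x y * Real.exp (-(ψ x + ψ y))) := by
      unfold meanIncrement
      rw [← integral_sub (hψi x) (hψi y)]
      exact abs_integral_le_of_ae_bound (hLip.mono fun σ h => h x y)
    -- Since t ≤ t ^ α for 0 ≤ t ≤ 1 and α ≤ 1, the Lipschitz bound on increments implies the Hölder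
    -- bound in D.
    have h2 : d x y * Real.exp (-(ψ x + ψ y)) ≤ Real.exp (α * (2 * K)) * D x y := by
      refine le_trans ?_ (hψF x y)
      rw [← hDψ]
      exact Real.self_le_rpow_of_le_one (ht0 x y) (hd1 x y) hα1
    have := mul_le_mul_of_nonneg_left h2 hC
    linarith
  · intro x y
    have hi2 : Integrable (fun σ => α * ((F (act σ x) - F x) + (F (act σ y) - F y))) p :=
      ((hFi x).add (hFi y)).const_mul α
    have hval : ∫ σ, α * ((F (act σ x) - F x) + (F (act σ y) - F y)) ∂p =
        α * (meanIncrement p act F x + meanIncrement p act F y) := by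
      rw [integral_const_mul, integral_add (hFi x) (hFi y)]; rfl
    have hi1 : Integrable
        (fun σ => 1 - α * ((F (act σ x) - F x) + (F (act σ y) - F y))) p :=
      (integrable_const _).sub hi2
    calc ∫ σ, D (act σ x) (act σ y) ∂p
        ≤ ∫ σ, D x y * (1 - α * ((F (act σ x) - F x) + (F (act σ y) - F y)) + α * c) ∂p :=
          integral_mono_ae (hDi x y)
            ((hi1.add (integrable_const _)).const_mul _)
            (hexp.mono fun σ h => h x y)
      _ = D x y * (1 - α * (meanIncrement p act F x + meanIncrement p act F y) + α * c) := by
          rw [integral_const_mul, integral_add hi1 (integrable_const _),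
            integral_sub (integrable_const _) hi2, hval]
          simp
      _ ≤ (1 - α * c) * D x y := by
          rw [mul_comm]
          refine mul_le_mul_of_nonneg_right ?_ (hD0 x y)
          have := hdrift x
          have := hdrift y
          nlinarith

end RandomMaps

/-! ### Third-order expansion of the Lyapunov function -/

/-- Used to bound the polynomial remainders of the expansion uniformly, by compactness and without
computing constants. -/
lemma exists_bound_on_box {n : ℕ} {f : (Fin n → ℝ) → ℝ} (hf : Continuous f) (C : ℝ) :
    ∃ B, 0 ≤ B ∧ ∀ v : Fin n → ℝ, (∀ i, |v i| ≤ C) → |f v| ≤ B := by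
  have hK : IsCompact (Set.pi Set.univ fun _ : Fin n => Set.Icc (-C) C) :=
    isCompact_univ_pi fun _ => isCompact_Icc
  obtain ⟨B, hB⟩ := hK.exists_bound_of_continuousOn hf.continuousOn
  refine ⟨|B|, abs_nonneg _, fun v hv => (hB v fun i _ => abs_le.1 (hv i)).trans (le_abs_self B)⟩

lemma le_log_one_add {X : ℝ} (hX : |X| ≤ 1 / 2) :
    X - X ^ 2 / 2 - 2 * |X| ^ 3 ≤ Real.log (1 + X) := by
  have h := Real.abs_log_sub_add_sum_range_le (x := -X) (by rw [abs_neg]; linarith) 2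
  rw [abs_neg] at h
  have h1 : |X| ^ (2 + 1) / (1 - |X|) ≤ 2 * |X| ^ 3 := by
    rw [div_le_iff₀ (by linarith)]
    have h3 : |X| ^ (2 + 1) = |X| ^ 3 := rfl
    nlinarith [pow_nonneg (abs_nonneg X) 3]
  have h2 := (abs_le.1 (h.trans h1)).1
  simp only [Finset.sum_range_succ, Finset.sum_range_zero, sub_neg_eq_add] at h2
  norm_num at h2
  linarith

lemma inv_one_add_le {X : ℝ} (hX : |X| ≤ 1 / 2) :
    1 / (1 + X) ≤ 1 - X + X ^ 2 + 2 * |X| ^ 3 := by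
  have h0 := abs_le.1 hX
  have h1 : -(X ^ 3) ≤ |X| ^ 3 := by rw [← abs_pow]; exact neg_le_abs _
  rw [div_le_iff₀ (by linarith)]
  nlinarith [pow_nonneg (abs_nonneg X) 3]

set_option maxHeartbeats 1000000 in
/-- Expansion in `η` of `log |w| - 3 w₂² / |w|²` along a small perturbation `w` of a unit vector
`z` that acts, to lowest order, through a nilpotent matrix. -/
lemma exists_lyapunov_expansion (C : ℝ) (hC : 1 ≤ C) :
    ∃ B, 0 ≤ B ∧ ∃ η₀ > 0, ∀ η a b₁ b₂ f₁ f₂ z₁ z₂ : ℝ, 0 ≤ η → η ≤ η₀ →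
      |a| ≤ C → |b₁| ≤ C → |b₂| ≤ C → |f₁| ≤ C → |f₂| ≤ C → z₁ ^ 2 + z₂ ^ 2 = 1 →
      ∀ w₁ w₂ : ℝ, w₁ = z₁ + η * a * z₂ + η ^ 2 * b₁ * z₁ + η ^ 3 * f₁ →
      w₂ = z₂ + η ^ 2 * b₂ * z₂ + η ^ 3 * f₂ →
      η * (a * (z₁ * z₂ + 6 * z₁ * z₂ ^ 3)) +
        η ^ 2 * (a ^ 2 * (z₂ ^ 2 / 2 - z₁ ^ 2 * z₂ ^ 2 + 3 * z₂ ^ 4 - 12 * z₁ ^ 2 * z₂ ^ 4) +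
          b₁ * (z₁ ^ 2 + 6 * z₁ ^ 2 * z₂ ^ 2) + b₂ * (z₂ ^ 2 - 6 * z₁ ^ 2 * z₂ ^ 2)) - B * η ^ 3 ≤
      Real.log (w₁ ^ 2 + w₂ ^ 2) / 2 - 3 * (w₂ ^ 2 / (w₁ ^ 2 + w₂ ^ 2) - z₂ ^ 2) := by
  -- `Z` and `Y` are the coefficients of η³, higher powers included, in w₂² and in w₁² + w₂². The
  -- variables are η, a, b₁, b₂, f₁, f₂, z₁, z₂ in this order.
  obtain ⟨Z, hZ⟩ : ∃ Z : (Fin 8 → ℝ) → ℝ, Z = fun v => 2 * v 7 * v 5 + v 0 * (v 3 * v 7) ^ 2 +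
    2 * v 0 ^ 2 * (v 3 * v 7) * v 5 + v 0 ^ 3 * v 5 ^ 2 := ⟨_, rfl⟩
  obtain ⟨Y, hY⟩ : ∃ Y : (Fin 8 → ℝ) → ℝ, Y = fun v => 2 * v 6 * v 4 +
    2 * (v 1 * v 7) * (v 2 * v 6) + v 0 * ((v 2 * v 6) ^ 2 + 2 * (v 1 * v 7) * v 4) +
    2 * v 0 ^ 2 * (v 2 * v 6) * v 4 + v 0 ^ 3 * v 4 ^ 2 + Z v := ⟨_, rfl⟩
  obtain ⟨B₁, hB₁0, hB₁⟩ := exists_bound_on_box (f := Z) (by rw [hZ]; fun_prop) C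
  obtain ⟨B₂, hB₂0, hB₂⟩ := exists_bound_on_box (f := Y) (by rw [hY, hZ]; fun_prop) C
  obtain ⟨B₃, hB₃0, hB₃⟩ := exists_bound_on_box (n := 4)
    (f := fun v => 2 * v 0 * v 1 * v 2) (by fun_prop) C
  obtain ⟨B₄, hB₄0, hB₄⟩ := exists_bound_on_box (n := 5) (f := fun v =>
    v 0 ^ 2 * v 4 ^ 2 + 2 * v 1 * v 3 ^ 2 + 2 * v 2 * v 4 ^ 2) (by fun_prop) C
  obtain ⟨D, hD⟩ : ∃ D, D = C + B₁ + B₂ + B₃ + B₄ := ⟨_, rfl⟩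
  obtain ⟨B₅, hB₅0, hB₅⟩ := exists_bound_on_box (n := 4)
    (f := fun v => v 1 + v 0 * v 2 + v 0 ^ 2 * v 3) (by fun_prop) D
  obtain ⟨B₆, hB₆0, hB₆⟩ := exists_bound_on_box (n := 4)
    (f := fun v => v 1 ^ 2 + 2 * v 0 ^ 2 * v 2 * v 1 ^ 2 + v 0 ^ 3 * v 3) (by fun_prop) D
  -- With X = ηX₁ + η²X₂ + η³X₃, `S` is defined by X² = η²X₁² + η³S.
  obtain ⟨S, hS⟩ : ∃ S : (Fin 7 → ℝ) → ℝ, S = fun v => 2 * v 1 * v 2 +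
    v 0 * (v 2 ^ 2 + 2 * v 1 * v 3) + 2 * v 0 ^ 2 * v 2 * v 3 + v 0 ^ 3 * v 3 ^ 2 := ⟨_, rfl⟩
  obtain ⟨B₇, hB₇0, hB₇⟩ := exists_bound_on_box (n := 7)
    (f := fun v => v 3 / 2 - S v / 4 - 3 * (v 4 ^ 2 * (S v - v 3) + 2 * v 5 * v 4 ^ 2 *
      (-v 1 + v 0 * (v 1 ^ 2 - v 2) + v 0 ^ 2 * (S v - v 3)) +
      v 6 * (1 - v 0 * v 1 + v 0 ^ 2 * (v 1 ^ 2 - v 2) + v 0 ^ 3 * (S v - v 3))))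
    (by rw [hS]; fun_prop) D
  -- B₇ bounds the polynomial part of order η³; the other terms come from the cubic remainders of
  -- log(1 + X) / 2 and of 3W / (1 + X). The bound on η forces |X| ≤ 1/2.
  refine ⟨B₇ + B₅ ^ 3 + 6 * B₆ * B₅ ^ 3, by positivity, min 1 (1 / (2 * (B₅ + 1))),
    by positivity, ?_⟩
  intro η a b₁ b₂ f₁ f₂ z₁ z₂ hη0 hη ha hb₁ hb₂ hf₁ hf₂ hz w₁ w₂ hw₁ hw₂
  have hη1 : η ≤ 1 := hη.trans (min_le_left _ _)
  have hη2 : η * (2 * (B₅ + 1)) ≤ 1 := by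
    have := hη.trans (min_le_right _ _)
    rwa [le_div_iff₀ (by positivity)] at this
  have hηC : |η| ≤ C := by rw [abs_of_nonneg hη0]; linarith
  have hz₁ : |z₁| ≤ C := ((sq_le_one_iff_abs_le_one _).1 (by nlinarith)).trans hC
  have hz₂ : |z₂| ≤ C := ((sq_le_one_iff_abs_le_one _).1 (by nlinarith)).trans hC
  have k1 := hB₁ ![η, a, b₁, b₂, f₁, f₂, z₁, z₂] (by
    intro i; fin_cases i <;> simpa using by assumption)
  have k2 := hB₂ ![η, a, b₁, b₂, f₁, f₂, z₁, z₂] (by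
    intro i; fin_cases i <;> simpa using by assumption)
  have k3 := hB₃ ![a, z₁, z₂, z₂] (by
    intro i; fin_cases i <;> simpa using by assumption)
  have k4 := hB₄ ![a, b₁, b₂, z₁, z₂] (by
    intro i; fin_cases i <;> simpa using by assumption)
  obtain ⟨Z₀, hZ₀⟩ : ∃ t, t = Z ![η, a, b₁, b₂, f₁, f₂, z₁, z₂] := ⟨_, rfl⟩
  obtain ⟨X₃, hX₃⟩ : ∃ t, t = Y ![η, a, b₁, b₂, f₁, f₂, z₁, z₂] := ⟨_, rfl⟩
  obtain ⟨X₁, hX₁⟩ : ∃ t, t = 2 * a * z₁ * z₂ := ⟨_, rfl⟩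
  obtain ⟨X₂, hX₂⟩ : ∃ t, t = a ^ 2 * z₂ ^ 2 + 2 * b₁ * z₁ ^ 2 + 2 * b₂ * z₂ ^ 2 := ⟨_, rfl⟩
  rw [← hZ₀] at k1
  rw [← hX₃] at k2
  replace k3 : |X₁| ≤ B₃ := by simpa [hX₁] using k3
  replace k4 : |X₂| ≤ B₄ := by simpa [hX₂] using k4
  have d0 : |η| ≤ D := by linarith
  have d1 : |Z₀| ≤ D := by linarith
  have d2 : |X₁| ≤ D := by linarith
  have d3 : |X₂| ≤ D := by linarith
  have d4 : |X₃| ≤ D := by linarith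
  have d5 : |z₂| ≤ D := by linarith
  have d6 : |b₂| ≤ D := by linarith
  have k5 := hB₅ ![η, X₁, X₂, X₃] (by
    intro i; fin_cases i <;> simpa using by assumption)
  have k6 := hB₆ ![η, z₂, b₂, Z₀] (by
    intro i; fin_cases i <;> simpa using by assumption)
  have k7 := hB₇ ![η, X₁, X₂, X₃, z₂, b₂, Z₀] (by
    intro i; fin_cases i <;> simpa using by assumption)
  obtain ⟨S₀, hS₀⟩ : ∃ t, t = S ![η, X₁, X₂, X₃, z₂, b₂, Z₀] := ⟨_, rfl⟩
  rw [← hS₀] at k7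
  simp [hZ] at hZ₀
  simp [hY, hZ] at hX₃
  simp [hS] at hS₀
  simp at k5 k6 k7
  obtain ⟨X, hX⟩ : ∃ t, t = η * X₁ + η ^ 2 * X₂ + η ^ 3 * X₃ := ⟨_, rfl⟩
  obtain ⟨W, hW⟩ : ∃ t, t = z₂ ^ 2 + 2 * η ^ 2 * b₂ * z₂ ^ 2 + η ^ 3 * Z₀ := ⟨_, rfl⟩
  have hW2 : w₂ ^ 2 = W := by rw [hW, hZ₀, hw₂]; ring
  have hq : w₁ ^ 2 + w₂ ^ 2 = 1 + X := by
    rw [hX, hX₁, hX₂, hX₃, hw₁, hw₂]; linear_combination hz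
  have hXY : X = η * (X₁ + η * X₂ + η ^ 2 * X₃) := by rw [hX]; ring
  have hXabs : |X| ≤ η * B₅ := by
    rw [hXY, abs_mul, abs_of_nonneg hη0]; gcongr
  have hXhalf : |X| ≤ 1 / 2 := hXabs.trans (by nlinarith)
  have hX3 : |X| ^ 3 ≤ η ^ 3 * B₅ ^ 3 := by
    rw [← mul_pow]; gcongr
  have hWB : W ≤ B₆ := by
    refine le_trans (le_of_eq ?_) ((le_abs_self _).trans k6)
    rw [hW]
  -- The sign of W matters: only an upper bound for 1 / (1 + X) is available, and it is multiplied
  -- by W.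
  have hW0 : 0 ≤ W := by rw [← hW2]; positivity
  have hlog := le_log_one_add hXhalf
  have hinv := mul_le_mul_of_nonneg_left (inv_one_add_le hXhalf) hW0
  have hpoly := mul_le_mul_of_nonneg_left (abs_le.1 k7).1 (pow_nonneg hη0 3)
  have hWX : W * |X| ^ 3 ≤ B₆ * (η ^ 3 * B₅ ^ 3) := by gcongr
  rw [hq, hW2, div_eq_mul_one_div W]
  have hid : (X - X ^ 2 / 2) / 2 - 3 * (W * (1 - X + X ^ 2) - z₂ ^ 2) =
      η * (X₁ / 2 + 3 * z₂ ^ 2 * X₁) + η ^ 2 * (X₂ / 2 - X₁ ^ 2 / 4 -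
        3 * (2 * b₂ * z₂ ^ 2 - z₂ ^ 2 * X₂ + z₂ ^ 2 * X₁ ^ 2)) +
      η ^ 3 * (X₃ / 2 - S₀ / 4 - 3 * (z₂ ^ 2 * (S₀ - X₃) + 2 * b₂ * z₂ ^ 2 *
        (-X₁ + η * (X₁ ^ 2 - X₂) + η ^ 2 * (S₀ - X₃)) +
        Z₀ * (1 - η * X₁ + η ^ 2 * (X₁ ^ 2 - X₂) + η ^ 3 * (S₀ - X₃)))) := by
    rw [hW, hX, hS₀]; ring
  have hmain : η * (X₁ / 2 + 3 * z₂ ^ 2 * X₁) + η ^ 2 * (X₂ / 2 - X₁ ^ 2 / 4 -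
        3 * (2 * b₂ * z₂ ^ 2 - z₂ ^ 2 * X₂ + z₂ ^ 2 * X₁ ^ 2)) =
      η * (a * (z₁ * z₂ + 6 * z₁ * z₂ ^ 3)) +
        η ^ 2 * (a ^ 2 * (z₂ ^ 2 / 2 - z₁ ^ 2 * z₂ ^ 2 + 3 * z₂ ^ 4 - 12 * z₁ ^ 2 * z₂ ^ 4) +
          b₁ * (z₁ ^ 2 + 6 * z₁ ^ 2 * z₂ ^ 2) + b₂ * (z₂ ^ 2 - 6 * z₁ ^ 2 * z₂ ^ 2)) := by
    rw [hX₁, hX₂]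
    linear_combination (η ^ 2 * 6 * b₂ * z₂ ^ 2) * hz
  linarith [hlog, hinv, hpoly, hWX, hid, hmain, hX3]

/-! ### SL(2, ℝ) acting on vectors: log-norm and determinant -/

/-- The nonzero vectors of the plane. -/
abbrev NonzeroVec := {x : Fin 2 → ℝ // x ≠ 0}

lemma NonzeroVec.normSq_pos (x : NonzeroVec) : 0 < x.1 0 ^ 2 + x.1 1 ^ 2 := by
  by_contra! h
  apply x.2
  ext i
  fin_cases i
  · change x.1 0 = 0
    exact pow_eq_zero_iff two_ne_zero |>.1 (by nlinarith [sq_nonneg (x.1 0), sq_nonneg (x.1 1)])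
  · change x.1 1 = 0
    exact pow_eq_zero_iff two_ne_zero |>.1 (by nlinarith [sq_nonneg (x.1 0), sq_nonneg (x.1 1)])

lemma specialLinear_mulVec_ne_zero (A : SL(2, ℝ)) {x : Fin 2 → ℝ} (hx : x ≠ 0) :
    (A : Matrix (Fin 2) (Fin 2) ℝ).mulVec x ≠ 0 := fun h => by
  apply hx
  have h1 := congrArg ((A⁻¹ : SL(2, ℝ)) : Matrix (Fin 2) (Fin 2) ℝ).mulVec h
  rw [Matrix.mulVec_mulVec, ← Matrix.SpecialLinearGroup.coe_mul] at h1
  simpa using h1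

/-- The linear action of `SL(2, ℝ)` on nonzero vectors. -/
def slAct (A : SL(2, ℝ)) (x : NonzeroVec) : NonzeroVec :=
  ⟨(A : Matrix (Fin 2) (Fin 2) ℝ).mulVec x.1, specialLinear_mulVec_ne_zero A x.2⟩

lemma slAct_zero (A : SL(2, ℝ)) (x : NonzeroVec) :
    (slAct A x).1 0 = A 0 0 * x.1 0 + A 0 1 * x.1 1 := by
  simp [slAct]

lemma slAct_one (A : SL(2, ℝ)) (x : NonzeroVec) :
    (slAct A x).1 1 = A 1 0 * x.1 0 + A 1 1 * x.1 1 := by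
  simp [slAct]

lemma measurable_slAct {Ω : Type*} [MeasurableSpace Ω] {τ : Ω → SL(2, ℝ)}
    (hτ : ∀ i j : Fin 2, Measurable fun σ => τ σ i j) :
    Measurable (Function.uncurry fun σ => slAct (τ σ)) := by
  refine Measurable.subtype_mk (measurable_pi_lambda _ fun i => ?_)
  have h : ∀ j, Measurable fun z : Ω × NonzeroVec => z.2.1 j := fun j =>
    (measurable_pi_apply j).comp (measurable_subtype_coe.comp measurable_snd)
  have h2 : ∀ i j, Measurable fun z : Ω × NonzeroVec => τ z.1 i j := fun i j =>
    (hτ i j).comp measurable_fst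
  simp only [Matrix.mulVec, dotProduct, Fin.sum_univ_two]
  exact ((h2 i 0).mul (h 0)).add ((h2 i 1).mul (h 1))

/-- The logarithm of the Euclidean norm. -/
noncomputable def logNorm (x : NonzeroVec) : ℝ := Real.log (x.1 0 ^ 2 + x.1 1 ^ 2) / 2

lemma measurable_coord (i : Fin 2) : Measurable fun x : NonzeroVec => x.1 i :=
  (measurable_pi_apply i).comp measurable_subtype_coe

lemma measurable_logNorm : Measurable logNorm := by
  have h0 := measurable_coord 0
  have h1 := measurable_coord 1
  exact (Real.measurable_log.comp ((h0.pow_const 2).add (h1.pow_const 2))).div_const 2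

lemma exp_logNorm_add (x y : NonzeroVec) : Real.exp (logNorm x + logNorm y) ^ 2 =
    (x.1 0 ^ 2 + x.1 1 ^ 2) * (y.1 0 ^ 2 + y.1 1 ^ 2) := by
  rw [← Real.exp_nat_mul, ← Real.exp_log x.normSq_pos, ← Real.exp_log y.normSq_pos,
    ← Real.exp_add]
  unfold logNorm
  congr 1
  push_cast
  ring

/-- The absolute value of the determinant of two vectors. -/
noncomputable def detDist (x y : NonzeroVec) : ℝ := |x.1 0 * y.1 1 - x.1 1 * y.1 0|

lemma slAct_det (A : SL(2, ℝ)) : A 0 0 * A 1 1 - A 0 1 * A 1 0 = 1 := by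
  have := A.det_coe
  rwa [Matrix.det_fin_two] at this

lemma detDist_slAct (A : SL(2, ℝ)) (x y : NonzeroVec) :
    detDist (slAct A x) (slAct A y) = detDist x y := by
  unfold detDist
  rw [slAct_zero, slAct_one, slAct_zero, slAct_one]
  congr 1
  linear_combination (x.1 0 * y.1 1 - x.1 1 * y.1 0) * slAct_det A

/-- The left side is the absolute sine of the angle between x and y; the proof is Lagrange's
identity. -/
lemma detDist_mul_exp_le (x y : NonzeroVec) :
    detDist x y * Real.exp (-(logNorm x + logNorm y)) ≤ 1 := by
  rw [Real.exp_neg, ← div_eq_mul_inv, div_le_one (Real.exp_pos _)]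
  refine abs_le_of_sq_le_sq ?_ (Real.exp_pos _).le
  rw [exp_logNorm_add]
  nlinarith [sq_nonneg (x.1 0 * y.1 0 + x.1 1 * y.1 1)]

lemma row_sq_le {C a b u v : ℝ} (ha : |a| ≤ C) (hb : |b| ≤ C) :
    (a * u + b * v) ^ 2 ≤ 2 * C ^ 2 * (u ^ 2 + v ^ 2) := by
  have h1 : a ^ 2 ≤ C ^ 2 := sq_le_sq.2 (ha.trans (le_abs_self _))
  have h2 : b ^ 2 ≤ C ^ 2 := sq_le_sq.2 (hb.trans (le_abs_self _))
  nlinarith [sq_nonneg (a * v - b * u), sq_nonneg u, sq_nonneg v,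
    mul_nonneg (sub_nonneg.2 h1) (add_nonneg (sq_nonneg u) (sq_nonneg v)),
    mul_nonneg (sub_nonneg.2 h2) (add_nonneg (sq_nonneg u) (sq_nonneg v))]

lemma normSq_slAct_le {A : SL(2, ℝ)} {C : ℝ} (hA : ∀ i j, |A i j| ≤ C) (x : NonzeroVec) :
    (slAct A x).1 0 ^ 2 + (slAct A x).1 1 ^ 2 ≤ 4 * C ^ 2 * (x.1 0 ^ 2 + x.1 1 ^ 2) := by
  rw [slAct_zero, slAct_one]
  linarith [row_sq_le (hA 0 0) (hA 0 1) (u := x.1 0) (v := x.1 1),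
    row_sq_le (hA 1 0) (hA 1 1) (u := x.1 0) (v := x.1 1)]

/-- As det A = 1, the inverse has the entries of A up to sign and position, hence the same bound. -/
lemma le_normSq_slAct {A : SL(2, ℝ)} {C : ℝ} (hA : ∀ i j, |A i j| ≤ C) (x : NonzeroVec) :
    x.1 0 ^ 2 + x.1 1 ^ 2 ≤ 4 * C ^ 2 * ((slAct A x).1 0 ^ 2 + (slAct A x).1 1 ^ 2) := by
  have h0 : x.1 0 = A 1 1 * (slAct A x).1 0 + -A 0 1 * (slAct A x).1 1 := by
    rw [slAct_zero, slAct_one]; linear_combination -(x.1 0) * slAct_det A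
  have h1 : x.1 1 = -A 1 0 * (slAct A x).1 0 + A 0 0 * (slAct A x).1 1 := by
    rw [slAct_zero, slAct_one]; linear_combination -(x.1 1) * slAct_det A
  have k0 := row_sq_le (hA 1 1) (b := -A 0 1) (by rw [abs_neg]; exact hA 0 1)
    (u := (slAct A x).1 0) (v := (slAct A x).1 1)
  have k1 := row_sq_le (a := -A 1 0) (by rw [abs_neg]; exact hA 1 0) (hA 0 0)
    (u := (slAct A x).1 0) (v := (slAct A x).1 1)
  rw [← h0] at k0
  rw [← h1] at k1
  linarith

lemma abs_log_sub_log_le {a b m : ℝ} (hm : 0 < m) (ha : m ≤ a) (hb : m ≤ b) :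
    |Real.log a - Real.log b| ≤ |a - b| / m := by
  have key : ∀ a b : ℝ, m ≤ a → m ≤ b → Real.log a - Real.log b ≤ |a - b| / m := by
    intro a b ha hb
    have ha0 := hm.trans_le ha
    have hb0 := hm.trans_le hb
    rw [← Real.log_div ha0.ne' hb0.ne']
    calc Real.log (a / b) ≤ a / b - 1 := Real.log_le_sub_one_of_pos (by positivity)
      _ = (a - b) / b := by field_simp
      _ ≤ |a - b| / b := by gcongr; exact le_abs_self _
      _ ≤ |a - b| / m := by gcongr
  refine abs_le.2 ⟨?_, key a b ha hb⟩
  have := key b a hb ha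
  rw [abs_sub_comm] at this
  linarith

lemma abs_log_ratio_le {a b m : ℝ} (hb : 0 < b) (ha : 0 < a) (h1 : a ≤ m * b) (h2 : b ≤ m * a) :
    |Real.log a - Real.log b| ≤ Real.log m := by
  have hm : 0 < m := by
    by_contra! h
    nlinarith
  have k1 := Real.log_le_log ha h1
  have k2 := Real.log_le_log hb h2
  rw [Real.log_mul hm.ne' hb.ne'] at k1
  rw [Real.log_mul hm.ne' ha.ne'] at k2
  exact abs_le.2 ⟨by linarith, by linarith⟩

lemma abs_logNorm_slAct_sub_le {A : SL(2, ℝ)} {C : ℝ} (hA : ∀ i j, |A i j| ≤ C) (x : NonzeroVec) :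
    |logNorm (slAct A x) - logNorm x| ≤ Real.log (4 * C ^ 2) / 2 := by
  have := abs_log_ratio_le x.normSq_pos (slAct A x).normSq_pos (normSq_slAct_le hA x)
    (le_normSq_slAct hA x)
  unfold logNorm
  rw [← sub_div, abs_div, abs_two]
  gcongr

/-- The difference is antisymmetric under exchange of (u, v) and (s, t), hence divisible by their
determinant. The cofactor is linear in ut + vs and vt - us, both at most r by Lagrange's identity.
-/
lemma quadratic_cross_bound {C a b c d u v s t r : ℝ} (ha : |a| ≤ C) (hb : |b| ≤ C) (hc : |c| ≤ C)
    (hd : |d| ≤ C) (hr : 0 ≤ r) (hrs : r ^ 2 = (u ^ 2 + v ^ 2) * (s ^ 2 + t ^ 2)) :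
    |((a * u + b * v) ^ 2 + (c * u + d * v) ^ 2) * (s ^ 2 + t ^ 2) -
      ((a * s + b * t) ^ 2 + (c * s + d * t) ^ 2) * (u ^ 2 + v ^ 2)| ≤
      8 * C ^ 2 * |u * t - v * s| * r := by
  have hC : 0 ≤ C := (abs_nonneg _).trans ha
  have h1 : |u * t + v * s| ≤ r := abs_le_of_sq_le_sq
    (by nlinarith [sq_nonneg (u * s - v * t)]) hr
  have h2 : |v * t - u * s| ≤ r := abs_le_of_sq_le_sq
    (by nlinarith [sq_nonneg (u * t + v * s)]) hr
  have hsq : ∀ x y : ℝ, |x| ≤ C → |y| ≤ C → |x * y| ≤ C ^ 2 := fun x y hx hy => by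
    rw [abs_mul, sq]; gcongr
  have h3 : |a * a + c * c - b * b - d * d| ≤ 4 * C ^ 2 := by
    have k1 := abs_le.1 (hsq a a ha ha)
    have k2 := abs_le.1 (hsq b b hb hb)
    have k3 := abs_le.1 (hsq c c hc hc)
    have k4 := abs_le.1 (hsq d d hd hd)
    exact abs_le.2 ⟨by linarith, by linarith⟩
  have h4 : |2 * (a * b + c * d)| ≤ 4 * C ^ 2 := by
    have k1 := abs_le.1 (hsq a b ha hb)
    have k2 := abs_le.1 (hsq c d hc hd)
    exact abs_le.2 ⟨by linarith, by linarith⟩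
  have hid : ((a * u + b * v) ^ 2 + (c * u + d * v) ^ 2) * (s ^ 2 + t ^ 2) -
      ((a * s + b * t) ^ 2 + (c * s + d * t) ^ 2) * (u ^ 2 + v ^ 2) =
      (u * t - v * s) * ((a * a + c * c - b * b - d * d) * (u * t + v * s) +
        2 * (a * b + c * d) * (v * t - u * s)) := by ring
  rw [hid, abs_mul]
  have h5 : |(a * a + c * c - b * b - d * d) * (u * t + v * s) +
        2 * (a * b + c * d) * (v * t - u * s)| ≤ 8 * C ^ 2 * r := by
    refine (abs_add_le _ _).trans ?_
    rw [abs_mul, abs_mul (2 * (a * b + c * d))]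
    have := mul_le_mul h3 h1 (abs_nonneg _) (by positivity)
    have := mul_le_mul h4 h2 (abs_nonneg _) (by positivity)
    linarith
  have := mul_le_mul_of_nonneg_left h5 (abs_nonneg (u * t - v * s))
  linarith

/-- The increment of the log-norm depends only on the direction, and is Lipschitz for the sine
distance. The constant is 8C² from `quadratic_cross_bound`, times 4C² from the lower bound on the
ratios under the logarithm, times the 1/2 in `logNorm`. -/
lemma abs_logNorm_increment_sub_le {A : SL(2, ℝ)} {C : ℝ} (hC : 1 ≤ C) (hA : ∀ i j, |A i j| ≤ C)
    (x y : NonzeroVec) :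
    |(logNorm (slAct A x) - logNorm x) - (logNorm (slAct A y) - logNorm y)| ≤
      16 * C ^ 4 * (detDist x y * Real.exp (-(logNorm x + logNorm y))) := by
  obtain ⟨r, hr⟩ : ∃ r, r = Real.exp (logNorm x + logNorm y) := ⟨_, rfl⟩
  have hr0 : 0 < r := by rw [hr]; exact Real.exp_pos _
  have hr2 := exp_logNorm_add x y
  rw [← hr] at hr2
  have hcross := quadratic_cross_bound (hA 0 0) (hA 0 1) (hA 1 0) (hA 1 1) hr0.le hr2
  rw [← slAct_zero, ← slAct_zero, ← slAct_one, ← slAct_one] at hcross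
  have hx := x.normSq_pos
  have hy := y.normSq_pos
  have hx' := (slAct A x).normSq_pos
  have hy' := (slAct A y).normSq_pos
  have ex := le_normSq_slAct hA x
  have ey := le_normSq_slAct hA y
  rw [Real.exp_neg, ← hr]
  unfold logNorm detDist
  obtain ⟨n, hn⟩ : ∃ n, n = x.1 0 ^ 2 + x.1 1 ^ 2 := ⟨_, rfl⟩
  obtain ⟨m, hm⟩ : ∃ m, m = y.1 0 ^ 2 + y.1 1 ^ 2 := ⟨_, rfl⟩
  obtain ⟨n', hn'⟩ : ∃ n', n' = (slAct A x).1 0 ^ 2 + (slAct A x).1 1 ^ 2 := ⟨_, rfl⟩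
  obtain ⟨m', hm'⟩ : ∃ m', m' = (slAct A y).1 0 ^ 2 + (slAct A y).1 1 ^ 2 := ⟨_, rfl⟩
  rw [← hn, ← hm] at hr2
  rw [← hn, ← hm, ← hn', ← hm'] at hcross ⊢
  rw [← hn] at hx ex
  rw [← hm] at hy ey
  rw [← hn'] at hx' ex
  rw [← hm'] at hy' ey
  have hC0 : 0 < C := by linarith
  have e1 : Real.log n' / 2 - Real.log n / 2 - (Real.log m' / 2 - Real.log m / 2) =
      (Real.log (n' / n) - Real.log (m' / m)) / 2 := by
    rw [Real.log_div hx'.ne' hx.ne', Real.log_div hy'.ne' hy.ne']; ring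
  have e2 := abs_log_sub_log_le (a := n' / n) (b := m' / m) (m := 1 / (4 * C ^ 2)) (by positivity)
    (by rw [div_le_div_iff₀ (by positivity) hx]; linarith)
    (by rw [div_le_div_iff₀ (by positivity) hy]; linarith)
  have e3 : n' / n - m' / m = (n' * m - m' * n) / r ^ 2 := by
    rw [hr2]; field_simp
  rw [e1, abs_div, abs_two]
  rw [e3, abs_div, abs_of_pos (by positivity : 0 < r ^ 2)] at e2
  calc _ ≤ |n' * m - m' * n| / r ^ 2 / (1 / (4 * C ^ 2)) / 2 := by gcongr
    _ ≤ (8 * C ^ 2 * |x.1 0 * y.1 1 - x.1 1 * y.1 0| * r) / r ^ 2 / (1 / (4 * C ^ 2)) / 2 := by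
        gcongr
    _ = _ := by field_simp; ring

/-- The unit vector `e_θ`. -/
noncomputable def angleVec (θ : ℝ) : NonzeroVec :=
  ⟨![Real.cos θ, Real.sin θ], fun h => by
    have h0 := congrFun h 0
    have h1 := congrFun h 1
    simp at h0 h1
    have := Real.sin_sq_add_cos_sq θ
    rw [h0, h1] at this
    norm_num at this⟩

lemma randomOrbit_slAct {Ω : Type*} (T : ℝ → Ω → SL(2, ℝ)) (l θ : ℝ) (w : ℕ → Ω) (N : ℕ) :
    (randomOrbit (fun σ => slAct (T l σ)) (angleVec θ) w N).1 =
      (transferProduct T l w N : Matrix (Fin 2) (Fin 2) ℝ).mulVec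
        ![Real.cos θ, Real.sin θ] := by
  induction N with
  | zero => simp [randomOrbit, transferProduct, angleVec]
  | succ N ih =>
    simp only [randomOrbit, transferProduct, slAct, ih, Matrix.SpecialLinearGroup.coe_mul,
      Matrix.mulVec_mulVec]

lemma logGrowth_eq {Ω : Type*} (T : ℝ → Ω → SL(2, ℝ)) (l θ : ℝ) (N : ℕ) (w : ℕ → Ω) :
    logGrowth T l θ N w =
      logNorm (randomOrbit (fun σ => slAct (T l σ)) (angleVec θ) w N) := by
  unfold logGrowth logNorm
  rw [← randomOrbit_slAct, EuclideanSpace.norm_eq, Real.log_sqrt (by positivity)]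
  simp [Fin.sum_univ_two]

/-- Existence of the Lyapunov exponent and a bound from below, from a Lyapunov function with positive
drift; a further function bounds it from above. -/
theorem exists_hasLyapunovExponent {Ω : Type*} [MeasurableSpace Ω] {p : Measure Ω}
    [IsProbabilityMeasure p] {T : ℝ → Ω → SL(2, ℝ)} {l : ℝ}
    (hτ : ∀ i j : Fin 2, Measurable fun σ => T l σ i j) {C : ℝ}
    (hC : ∀ᵐ σ ∂p, ∀ i j : Fin 2, |T l σ i j| ≤ C)
    {F G : NonzeroVec → ℝ} (hF : Measurable F) (hG : Measurable G) {K : ℝ}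
    (hFK : ∀ y, |F y - logNorm y| ≤ K) (hGK : ∀ y, |G y - logNorm y| ≤ K)
    {c c' : ℝ} (hc : 0 < c)
    (hFc : ∀ y, c ≤ meanIncrement p (fun σ => slAct (T l σ)) F y)
    (hGc : ∀ y, meanIncrement p (fun σ => slAct (T l σ)) G y ≤ c') :
    ∃ γ, HasLyapunovExponent p T l γ ∧ c ≤ γ ∧ γ ≤ c' := by
  have hact := measurable_slAct hτ
  have : Nonempty NonzeroVec := ⟨angleVec 0⟩
  obtain ⟨C₁, hC₁⟩ : ∃ C₁, C₁ = max C 1 := ⟨_, rfl⟩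
  have hC1 : 1 ≤ C₁ := by rw [hC₁]; exact le_max_right _ _
  replace hC : ∀ᵐ σ ∂p, ∀ i j : Fin 2, |T l σ i j| ≤ C₁ :=
    hC.mono fun σ h i j => (h i j).trans (by rw [hC₁]; exact le_max_left _ _)
  have hL : ∀ᵐ σ ∂p, ∀ y, |logNorm (slAct (T l σ) y) - logNorm y| ≤
      Real.log (4 * C₁ ^ 2) / 2 := hC.mono fun σ h y => abs_logNorm_slAct_sub_le h y
  have hincr : ∀ H : NonzeroVec → ℝ, (∀ y, |H y - logNorm y| ≤ K) →
      ∀ᵐ σ ∂p, ∀ y, |H (slAct (T l σ) y) - H y| ≤ Real.log (4 * C₁ ^ 2) / 2 + 2 * K :=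
    fun H hH => hL.mono fun σ h y => by
      have h1 := abs_le.1 (h y)
      have h2 := abs_le.1 (hH y)
      have h3 := abs_le.1 (hH (slAct (T l σ) y))
      exact abs_le.2 ⟨by linarith, by linarith⟩
  obtain ⟨γ, hγ⟩ := exists_tendsto_growth (p := p) hact measurable_logNorm hL hF hFK hc hFc
    (d := detDist) (fun _ _ => abs_nonneg _) (fun σ => detDist_slAct (T l σ)) detDist_mul_exp_le
    (C := 16 * C₁ ^ 4) (by positivity) (hC.mono fun σ h => abs_logNorm_increment_sub_le hC1 h)
  have hint : ∀ (x : NonzeroVec) (N : ℕ),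
      Integrable (fun w => logNorm (randomOrbit (fun σ => slAct (T l σ)) x w N))
        (Measure.infinitePi fun _ : ℕ => p) := fun x N =>
    integrable_randomOrbit hact x measurable_logNorm hL N
  refine ⟨γ, fun θ => ⟨fun N => ?_, ?_⟩, ?_, ?_⟩
  · exact (hint (angleVec θ) N).congr (ae_of_all _ fun w => (logGrowth_eq T l θ N w).symm)
  · simp only [logGrowth_eq]
    exact hγ _
  · exact le_of_tendsto_growth hact (angleVec 0) hF (hincr F hFK) hFc hFK (hint _) (hγ _)
  -- The upper bound is the lower bound applied to -G, -`logNorm` and -γ.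
  · have := le_of_tendsto_growth hact (angleVec 0) (f := fun y => -G y)
      (ψ := fun y => -logNorm y) hG.neg (L := Real.log (4 * C₁ ^ 2) / 2 + 2 * K)
      ((hincr G hGK).mono fun σ h y => by
        rw [← abs_neg]; simpa [sub_eq_add_neg, add_comm] using h y)
      (c := -c') (fun y => ?_) (K := K) (fun y => ?_) (fun N => (hint _ N).neg) (γ := -γ) ?_
    · linarith
    · have h1 := hGc y
      have h2 : meanIncrement p (fun σ => slAct (T l σ)) (fun y => -G y) y =
          -meanIncrement p (fun σ => slAct (T l σ)) G y := by
        unfold meanIncrement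
        rw [← integral_neg]
        congr 1; ext σ; ring
      rw [h2]; linarith
    · rw [← abs_neg]; simpa [sub_eq_add_neg, add_comm] using hGK y
    · simpa [integral_neg] using (hγ (angleVec 0)).neg

/-! ### Taylor expansion, uniform bounds and measurability of the random family -/

lemma abs_taylor_two_le {f : ℝ → ℝ} (hf : ContDiff ℝ ∞ f) {C l : ℝ} (hl : |l| ≤ 1)
    (hC : ∀ t, |t| ≤ 1 → |iteratedDeriv 2 f t| ≤ C) :
    |f l - f 0 - l * deriv f 0| ≤ C * l ^ 2 := by
  have hd : Differentiable ℝ f := hf.differentiable (by simp)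
  have hd' : Differentiable ℝ (deriv f) := by
    have := hf.differentiable_iteratedDeriv 1 (by exact_mod_cast ENat.natCast_lt_top 1)
    rwa [iteratedDeriv_one] at this
  have hmem : ∀ t ∈ Set.Icc (-|l|) |l|, |t| ≤ |l| := fun t ht => abs_le.2 ht
  have h0 : (0 : ℝ) ∈ Set.Icc (-|l|) |l| := by simp
  have h1 : ∀ t ∈ Set.Icc (-|l|) |l|, ‖deriv f t - deriv f 0‖ ≤ C * ‖t - 0‖ := fun t ht =>
    Convex.norm_image_sub_le_of_norm_deriv_le (f := deriv f) (s := Set.Icc (-|l|) |l|)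
      (fun x _ => hd' x) (fun x hx => by
        have := hC x ((hmem x hx).trans hl)
        rwa [iteratedDeriv_succ, iteratedDeriv_one] at this) (convex_Icc _ _) h0 ht
  have hC0 : 0 ≤ C := (abs_nonneg _).trans (hC 0 (by simp))
  have h2 := Convex.norm_image_sub_le_of_norm_deriv_le (f := fun t => f t - t * deriv f 0)
    (s := Set.Icc (-|l|) |l|) (C := C * |l|) (x := 0) (y := l)
    (fun x _ => (hd x).sub (differentiableAt_fun_id.mul_const _)) (fun x hx => by
      have : deriv (fun t => f t - t * deriv f 0) x = deriv f x - deriv f 0 := by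
        rw [deriv_fun_sub (hd x) (differentiableAt_fun_id.mul_const _)]
        simp
      rw [this]
      refine (h1 x hx).trans ?_
      rw [sub_zero, Real.norm_eq_abs]
      exact mul_le_mul_of_nonneg_left (hmem x hx) hC0) (convex_Icc _ _) h0
      (abs_le.1 le_rfl)
  simp only [Real.norm_eq_abs, sub_zero, zero_mul] at h2
  calc _ = |f l - l * deriv f 0 - f 0| := by congr 1; ring
    _ ≤ C * |l| * |l| := h2
    _ = C * l ^ 2 := by rw [mul_assoc, ← sq, sq_abs]

lemma abs_eq_one_of_mul_self {s : ℝ} (hs : s * s = 1) : |s| = 1 := by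
  rcases mul_self_eq_one_iff.1 hs with h | h <;> simp [h]

section Family

variable {Ω : Type*} {T : ℝ → Ω → SL(2, ℝ)}

lemma coe_inv_of_firstOrder (hA : IsFirstOrderAnomaly T) (σ : Ω) :
    ∃ s : ℝ, s * s = 1 ∧ (T 0 σ : Matrix (Fin 2) (Fin 2) ℝ) = s • 1 ∧
      (((T 0 σ)⁻¹ : SL(2, ℝ)) : Matrix (Fin 2) (Fin 2) ℝ) = s • 1 := by
  rcases hA σ with h | h
  · refine ⟨1, by norm_num, by simpa using h, ?_⟩
    rw [Matrix.SpecialLinearGroup.coe_inv, h, Matrix.adjugate_one, one_smul]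
  · refine ⟨-1, by norm_num, by simpa using h, ?_⟩
    rw [Matrix.SpecialLinearGroup.coe_inv, h]
    ext i j
    fin_cases i <;> fin_cases j <;> simp [Matrix.adjugate_fin_two]

lemma firstOrderP_eq (T : ℝ → Ω → SL(2, ℝ)) (M : SL(2, ℝ)) (σ : Ω) :
    firstOrderP T M σ = (M : Matrix (Fin 2) (Fin 2) ℝ) * firstOrderP T 1 σ *
      ((M⁻¹ : SL(2, ℝ)) : Matrix (Fin 2) (Fin 2) ℝ) := by
  unfold firstOrderP
  simp [Matrix.mul_assoc]

lemma exists_entry_bound (M : SL(2, ℝ)) : ∃ m, ∀ i j, |M i j| ≤ m :=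
  ⟨∑ i, ∑ j, |M i j|, fun i j =>
    (Finset.single_le_sum (f := fun j => |M i j|) (fun _ _ => abs_nonneg _)
      (Finset.mem_univ j)).trans
    (Finset.single_le_sum (f := fun i => ∑ j, |M i j|)
      (fun _ _ => Finset.sum_nonneg fun _ _ => abs_nonneg _) (Finset.mem_univ i))⟩

lemma abs_conj_apply_le {M : SL(2, ℝ)} {m : ℝ} (hM : ∀ i j, |M i j| ≤ m)
    {B : Matrix (Fin 2) (Fin 2) ℝ} {b : ℝ} (hB : ∀ i j, |B i j| ≤ b) (i j : Fin 2) :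
    |((M : Matrix (Fin 2) (Fin 2) ℝ) * B * ((M⁻¹ : SL(2, ℝ)) : Matrix (Fin 2) (Fin 2) ℝ)) i j| ≤
      4 * m ^ 2 * b := by
  have hMi : ∀ i j, |((M⁻¹ : SL(2, ℝ)) : Matrix (Fin 2) (Fin 2) ℝ) i j| ≤ m := by
    intro i j
    rw [Matrix.SpecialLinearGroup.coe_inv, Matrix.adjugate_fin_two]
    have := hM 0 0; have := hM 0 1; have := hM 1 0; have := hM 1 1
    fin_cases i <;> fin_cases j <;> simpa
  have hm : 0 ≤ m := (abs_nonneg _).trans (hM 0 0)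
  have hb : 0 ≤ b := (abs_nonneg _).trans (hB 0 0)
  have h3 : ∀ i k n j, |M i k * B k n *
      ((M⁻¹ : SL(2, ℝ)) : Matrix (Fin 2) (Fin 2) ℝ) n j| ≤ m ^ 2 * b := by
    intro i k n j
    rw [abs_mul, abs_mul]
    calc _ ≤ m * b * m := by
          gcongr
          · exact hM i k
          · exact hB k n
          · exact hMi n j
      _ = _ := by ring
  have h00 := abs_le.1 (h3 i 0 0 j)
  have h01 := abs_le.1 (h3 i 0 1 j)
  have h10 := abs_le.1 (h3 i 1 0 j)
  have h11 := abs_le.1 (h3 i 1 1 j)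
  simp only [Matrix.mul_apply, Fin.sum_univ_two]
  refine abs_le.2 ⟨by linarith, by linarith⟩

/-- The transfer matrix in the basis `M`, with its sign removed. -/
noncomputable def conjTransfer (T : ℝ → Ω → SL(2, ℝ)) (M : SL(2, ℝ)) (l : ℝ) (σ : Ω) :
    Matrix (Fin 2) (Fin 2) ℝ :=
  (M : Matrix (Fin 2) (Fin 2) ℝ) *
    ((((T 0 σ)⁻¹ : SL(2, ℝ)) : Matrix (Fin 2) (Fin 2) ℝ) * (T l σ : Matrix (Fin 2) (Fin 2) ℝ)) *
      ((M⁻¹ : SL(2, ℝ)) : Matrix (Fin 2) (Fin 2) ℝ)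

lemma conj_mul_sub {n : Type*} [Fintype n] [DecidableEq n] {m m' s t₀ t d : Matrix n n ℝ} {l : ℝ}
    (hs : s * t₀ = 1) (hm : m * m' = 1) :
    m * (s * t) * m' - 1 - l • (m * s * d * m') = m * (s * (t - t₀ - l • d)) * m' := by
  simp only [Matrix.mul_sub, Matrix.sub_mul, hs, Matrix.mul_one, hm, Matrix.mul_smul,
    Matrix.smul_mul, Matrix.mul_assoc]

lemma conjTransfer_sub (T : ℝ → Ω → SL(2, ℝ)) (M : SL(2, ℝ)) (l : ℝ) (σ : Ω) :
    conjTransfer T M l σ - 1 - l • firstOrderP T M σ =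
      (M : Matrix (Fin 2) (Fin 2) ℝ) *
        ((((T 0 σ)⁻¹ : SL(2, ℝ)) : Matrix (Fin 2) (Fin 2) ℝ) *
          ((T l σ : Matrix (Fin 2) (Fin 2) ℝ) - (T 0 σ : Matrix (Fin 2) (Fin 2) ℝ) -
            l • derivAtZero T σ)) * ((M⁻¹ : SL(2, ℝ)) : Matrix (Fin 2) (Fin 2) ℝ) := by
  have h1 : (((T 0 σ)⁻¹ : SL(2, ℝ)) : Matrix (Fin 2) (Fin 2) ℝ) *
      (T 0 σ : Matrix (Fin 2) (Fin 2) ℝ) = 1 := by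
    rw [← Matrix.SpecialLinearGroup.coe_mul]; simp
  have h2 : (M : Matrix (Fin 2) (Fin 2) ℝ) *
      ((M⁻¹ : SL(2, ℝ)) : Matrix (Fin 2) (Fin 2) ℝ) = 1 := by
    rw [← Matrix.SpecialLinearGroup.coe_mul]; simp
  exact conj_mul_sub h1 h2

/-- The sign of T₀ survives only as a factor s with s² = 1, which is invisible to functions of the
squared coordinates. -/
lemma slAct_conj (hA : IsFirstOrderAnomaly T) (M : SL(2, ℝ)) (l : ℝ) (σ : Ω) (x : NonzeroVec) :
    ∃ s : ℝ, s * s = 1 ∧ ∀ i, (slAct M (slAct (T l σ) x)).1 i =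
      s * (conjTransfer T M l σ i 0 * (slAct M x).1 0 +
        conjTransfer T M l σ i 1 * (slAct M x).1 1) := by
  obtain ⟨s, hs, -, hs0⟩ := coe_inv_of_firstOrder hA σ
  refine ⟨s, hs, fun i => ?_⟩
  have h1 : (slAct M (slAct (T l σ) x)).1 = s • (conjTransfer T M l σ).mulVec (slAct M x).1 := by
    have h2 : ((M⁻¹ : SL(2, ℝ)) : Matrix (Fin 2) (Fin 2) ℝ) *
        (M : Matrix (Fin 2) (Fin 2) ℝ) = 1 := by
      rw [← Matrix.SpecialLinearGroup.coe_mul]; simp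
    simp only [slAct, conjTransfer, hs0, Matrix.mulVec_mulVec, Matrix.mul_assoc, h2,
      Matrix.smul_mul, Matrix.mul_smul, Matrix.one_mul, Matrix.mul_one, Matrix.smul_mulVec,
      smul_smul, hs, one_smul]
  rw [h1]
  simp only [Pi.smul_apply, smul_eq_mul, Matrix.mulVec, dotProduct, Fin.sum_univ_two]

variable [MeasurableSpace Ω] {p : Measure Ω}

/-- The derivative is the pointwise limit of the difference quotients at 1 / (n + 1). -/
lemma measurable_derivAtZero (hT : IsSmoothRandomFamily p T) (i j : Fin 2) :
    Measurable fun σ => derivAtZero T σ i j := by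
  refine measurable_of_tendsto_metrizable
    (f := fun (n : ℕ) σ => (1 / ((n : ℝ) + 1))⁻¹ * (T (1 / ((n : ℝ) + 1)) σ i j - T 0 σ i j))
    (fun n => ((hT.measurable _ i j).sub (hT.measurable _ i j)).const_mul _) ?_
  rw [tendsto_pi_nhds]
  intro σ
  have hd : HasDerivAt (fun l => T l σ i j) (deriv (fun l => T l σ i j) 0) 0 :=
    ((hT.smooth σ i j).differentiable (by simp) 0).hasDerivAt
  have h1 := hd.tendsto_slope_zero
  have h2 : Tendsto (fun n : ℕ => 1 / ((n : ℝ) + 1)) atTop (𝓝[≠] 0) :=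
    tendsto_nhdsWithin_iff.2 ⟨tendsto_one_div_add_atTop_nhds_zero_nat,
      Eventually.of_forall fun n => by simp; positivity⟩
  have h3 := h1.comp h2
  simpa [derivAtZero, Function.comp_def] using h3

lemma measurable_firstOrderP (hT : IsSmoothRandomFamily p T) (M : SL(2, ℝ)) (i j : Fin 2) :
    Measurable fun σ => firstOrderP T M σ i j := by
  have h1 := fun i j => measurable_derivAtZero hT i j
  have h2 : ∀ i j, Measurable fun σ =>
      (((T 0 σ)⁻¹ : SL(2, ℝ)) : Matrix (Fin 2) (Fin 2) ℝ) i j := by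
    intro i j
    have h := fun i j => hT.measurable 0 i j
    simp only [Matrix.SpecialLinearGroup.coe_inv, Matrix.adjugate_fin_two]
    have := h 0 0; have := h 0 1; have := h 1 0; have := h 1 1
    fin_cases i <;> fin_cases j <;> simp <;> assumption
  unfold firstOrderP
  simp only [Matrix.mul_apply, Fin.sum_univ_two]
  fun_prop

lemma exists_uniform_bound (hT : IsSmoothRandomFamily p T) (hA : IsFirstOrderAnomaly T)
    (M : SL(2, ℝ)) : ∃ C, 1 ≤ C ∧ ∀ᵐ σ ∂p, (∀ i j, |firstOrderP T M σ i j| ≤ C) ∧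
      ∀ l : ℝ, |l| ≤ 1 → (∀ i j, |T l σ i j| ≤ C) ∧
        ∀ i j, |(conjTransfer T M l σ - 1 - l • firstOrderP T M σ) i j| ≤ C * l ^ 2 := by
  obtain ⟨C₀, h₀⟩ := hT.bounded 0 1
  obtain ⟨C₁, h₁⟩ := hT.bounded 1 1
  obtain ⟨C₂, h₂⟩ := hT.bounded 2 1
  obtain ⟨m, hm⟩ := exists_entry_bound M
  have hsign : ∀ σ (B : Matrix (Fin 2) (Fin 2) ℝ) i j,
      |((((T 0 σ)⁻¹ : SL(2, ℝ)) : Matrix (Fin 2) (Fin 2) ℝ) * B) i j| = |B i j| := by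
    intro σ B i j
    obtain ⟨s, hs, -, hs0⟩ := coe_inv_of_firstOrder hA σ
    have := abs_eq_one_of_mul_self hs
    rw [hs0]
    simp [abs_mul, this]
  refine ⟨1 + |C₀| + 4 * m ^ 2 * |C₁| + 4 * m ^ 2 * |C₂|, ?_, ?_⟩
  · have := abs_nonneg C₀
    have : 0 ≤ 4 * m ^ 2 * |C₁| := by positivity
    have : 0 ≤ 4 * m ^ 2 * |C₂| := by positivity
    linarith
  have := abs_nonneg C₀
  have k1 : 0 ≤ 4 * m ^ 2 * |C₁| := by positivity
  have k2 : 0 ≤ 4 * m ^ 2 * |C₂| := by positivity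
  filter_upwards [h₀, h₁, h₂] with σ a₀ a₁ a₂
  refine ⟨fun i j => ?_, fun l hl => ⟨fun i j => ?_, fun i j => ?_⟩⟩
  · have h := abs_conj_apply_le hm (B := (((T 0 σ)⁻¹ : SL(2, ℝ)) : Matrix (Fin 2) (Fin 2) ℝ) *
      derivAtZero T σ) (b := |C₁|) (fun i j => by
        rw [hsign]
        have := a₁ 0 (by simp) i j
        rw [iteratedDeriv_one] at this
        exact this.trans (le_abs_self _)) i j
    rw [← Matrix.mul_assoc] at h
    change |firstOrderP T M σ i j| ≤ _ at h
    linarith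
  · have := a₀ l hl i j
    rw [iteratedDeriv_zero] at this
    linarith [le_abs_self C₀]
  · rw [conjTransfer_sub]
    have h := abs_conj_apply_le hm (B := (((T 0 σ)⁻¹ : SL(2, ℝ)) : Matrix (Fin 2) (Fin 2) ℝ) *
      ((T l σ : Matrix (Fin 2) (Fin 2) ℝ) - (T 0 σ : Matrix (Fin 2) (Fin 2) ℝ) -
            l • derivAtZero T σ)) (b := |C₂| * l ^ 2) (fun i j => by
        rw [hsign]
        have := abs_taylor_two_le (hT.smooth σ i j) hl (C := |C₂|)
          (fun t ht => (a₂ t ht i j).trans (le_abs_self _))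
        simpa [derivAtZero] using this) i j
    nlinarith [sq_nonneg l]

lemma integrable_firstOrderP [IsProbabilityMeasure p] (hT : IsSmoothRandomFamily p T)
    (hA : IsFirstOrderAnomaly T) (M : SL(2, ℝ)) (i j : Fin 2) :
    Integrable (fun σ => firstOrderP T M σ i j) p := by
  obtain ⟨C, -, hC⟩ := exists_uniform_bound hT hA M
  exact Integrable.of_bound (measurable_firstOrderP hT M i j).aestronglyMeasurable C
    (hC.mono fun σ h => h.1 i j)

end Family

/-! ### One-step increments of the two Lyapunov functions -/

/-- The Lyapunov function of the hyperbolic anomaly, in adapted coordinates; the diffusive scale is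
`y₁² ~ s y₂²`. -/
noncomputable def adaptedLog (s : ℝ) (y : NonzeroVec) : ℝ :=
  Real.log (y.1 0 ^ 2 + s * y.1 1 ^ 2) / 2 -
    3 * (s * y.1 1 ^ 2 / (y.1 0 ^ 2 + s * y.1 1 ^ 2))

lemma measurable_adaptedLog (s : ℝ) : Measurable (adaptedLog s) := by
  have h0 := measurable_coord 0
  have h1 := measurable_coord 1
  have hq : Measurable fun y : NonzeroVec => y.1 0 ^ 2 + s * y.1 1 ^ 2 :=
    (h0.pow_const 2).add ((h1.pow_const 2).const_mul s)
  exact ((Real.measurable_log.comp hq).div_const 2).sub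
    ((((h1.pow_const 2).const_mul s).div hq).const_mul 3)

lemma abs_adaptedLog_sub_le {s : ℝ} (hs : 0 < s) (y : NonzeroVec) :
    |adaptedLog s y - logNorm y| ≤ Real.log (1 + s + 1 / s) / 2 + 3 := by
  have hy := y.normSq_pos
  have h0 := sq_nonneg (y.1 0)
  have h1 := sq_nonneg (y.1 1)
  have hs1 : 0 < 1 / s := by positivity
  have hss : 1 / s * s = 1 := by field_simp
  have hq : 0 < y.1 0 ^ 2 + s * y.1 1 ^ 2 := by
    rcases h1.eq_or_lt with h | h
    · rw [← h] at hy ⊢; linarith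
    · positivity
  have k1 := abs_le.1 (abs_log_ratio_le (m := 1 + s + 1 / s) hy hq
    (by nlinarith [mul_nonneg hs.le h0, mul_nonneg hs1.le h0, mul_nonneg hs1.le h1])
    (by nlinarith [mul_nonneg hs.le h0, mul_nonneg hs1.le h0, mul_nonneg hs.le h1,
          mul_nonneg (mul_nonneg hs.le hs.le) h1]))
  have k2 : 0 ≤ s * y.1 1 ^ 2 / (y.1 0 ^ 2 + s * y.1 1 ^ 2) := by positivity
  have k3 : s * y.1 1 ^ 2 / (y.1 0 ^ 2 + s * y.1 1 ^ 2) ≤ 1 := by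
    rw [div_le_one hq]; linarith
  unfold adaptedLog logNorm
  exact abs_le.2 ⟨by linarith, by linarith⟩

/-- Rescaling divides the upper right entry by kη: this costs one power of η, so a Taylor remainder
of order η⁴ becomes one of order η³. -/
lemma abs_add_div_le_of_remainder {η k C e₁ e₂ z₁ z₂ : ℝ} (hη : 0 < η) (hη1 : η ≤ 1) (hk : 0 < k)
    (hC : 0 ≤ C) (h₁ : |e₁| ≤ C * η ^ 4) (h₂ : |e₂| ≤ C * η ^ 4) (hz₁ : |z₁| ≤ 1)
    (hz₂ : |z₂| ≤ 1) :
    |(e₁ * z₁ + e₂ / (k * η) * z₂) / η ^ 3| ≤ C * (1 + 1 / k) := by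
  rw [abs_div, abs_of_pos (by positivity : 0 < η ^ 3), div_le_iff₀ (by positivity)]
  calc |e₁ * z₁ + e₂ / (k * η) * z₂| ≤ |e₁| * |z₁| + |e₂| / (k * η) * |z₂| := by
        refine (abs_add_le _ _).trans (le_of_eq ?_)
        rw [abs_mul, abs_mul, abs_div, abs_of_pos (by positivity : 0 < k * η)]
    _ ≤ C * η ^ 4 * 1 + C * η ^ 4 / (k * η) * 1 := by gcongr
    _ = C * η ^ 3 * η + C * η ^ 3 / k := by field_simp
    _ ≤ C * η ^ 3 * 1 + C * η ^ 3 / k := by gcongr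
    _ = _ := by ring

/-- Rescaling multiplies the lower left entry by kη, so that whole entry, including its first-order
part, is O(η³) and joins the remainder. -/
lemma abs_add_div_le_of_offDiagonal {η k C e₁ e₂ z₁ z₂ : ℝ} (hη : 0 < η) (hη1 : η ≤ 1)
    (hk : 0 < k) (hC : 0 ≤ C) (h₁ : |e₁| ≤ 2 * C * η ^ 2) (h₂ : |e₂| ≤ C * η ^ 4) (hz₁ : |z₁| ≤ 1)
    (hz₂ : |z₂| ≤ 1) :
    |(k * η * e₁ * z₁ + e₂ * z₂) / η ^ 3| ≤ C * (1 + 2 * k) := by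
  rw [abs_div, abs_of_pos (by positivity : 0 < η ^ 3), div_le_iff₀ (by positivity)]
  calc |k * η * e₁ * z₁ + e₂ * z₂| ≤ k * η * |e₁| * |z₁| + |e₂| * |z₂| := by
        refine (abs_add_le _ _).trans (le_of_eq ?_)
        rw [abs_mul, abs_mul, abs_mul e₂, abs_of_pos (by positivity : 0 < k * η)]
    _ ≤ k * η * (2 * C * η ^ 2) * 1 + C * η ^ 4 * 1 := by gcongr
    _ = 2 * C * k * η ^ 3 + C * η ^ 3 * η := by ring
    _ ≤ 2 * C * k * η ^ 3 + C * η ^ 3 * 1 := by gcongr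
    _ = _ := by ring

-- Conjugation by diag(1, kη) brings the step into the form of `exists_lyapunov_expansion`, with a =
-- ς `P 0 1` / k. The unit vector z depends on y and η alone and is chosen before the matrices, so
-- that the bound can be averaged over σ with z fixed. Here ς is the sign of the coupling constant
-- and t that of T₀.
set_option maxHeartbeats 1000000 in
lemma exists_adaptedLog_step (C : ℝ) (hC : 1 ≤ C) (k : ℝ) (hk : 0 < k) :
    ∃ B, 0 ≤ B ∧ ∃ η₀ > 0, ∀ η, 0 < η → η ≤ η₀ → ∀ y : NonzeroVec, ∃ z₁ z₂ : ℝ,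
      z₁ ^ 2 + z₂ ^ 2 = 1 ∧ ∀ ς : ℝ, ς * ς = 1 → ∀ P W : Matrix (Fin 2) (Fin 2) ℝ,
      (∀ i j, |P i j| ≤ C) →
      (∀ i j, |(W - 1 - (ς * η ^ 2) • P) i j| ≤ C * (ς * η ^ 2) ^ 2) →
      ∀ (y' : NonzeroVec) (t : ℝ), t * t = 1 →
      (∀ i, y'.1 i = t * (W i 0 * y.1 0 + W i 1 * y.1 1)) →
      η * (ς * P 0 1 / k * (z₁ * z₂ + 6 * z₁ * z₂ ^ 3)) +
        η ^ 2 * (P 0 1 ^ 2 / k ^ 2 *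
            (z₂ ^ 2 / 2 - z₁ ^ 2 * z₂ ^ 2 + 3 * z₂ ^ 4 - 12 * z₁ ^ 2 * z₂ ^ 4) +
          ς * P 0 0 * (z₁ ^ 2 + 6 * z₁ ^ 2 * z₂ ^ 2) +
          ς * P 1 1 * (z₂ ^ 2 - 6 * z₁ ^ 2 * z₂ ^ 2)) - B * η ^ 3 ≤
      adaptedLog ((k * η) ^ 2) y' - adaptedLog ((k * η) ^ 2) y := by
  have hC0 : 0 < C := by linarith
  obtain ⟨C', hC'⟩ : ∃ C', C' = C * (2 + 1 / k + 2 * k) := ⟨_, rfl⟩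
  have hk1 : 0 < 1 / k := by positivity
  have hCC' : C ≤ C' := by rw [hC']; nlinarith
  have hCk : C / k ≤ C' := by
    rw [hC', div_eq_mul_one_div]
    gcongr
    linarith
  have hf₁' : C * (1 + 1 / k) ≤ C' := by rw [hC']; nlinarith
  have hf₂' : C * (1 + 2 * k) ≤ C' := by rw [hC']; nlinarith
  obtain ⟨B, hB0, η₀, hη₀, hexp⟩ := exists_lyapunov_expansion C' (hC.trans hCC')
  refine ⟨B, hB0, min η₀ 1, by positivity, fun η hη hηle y => ?_⟩
  have hη1 : η ≤ 1 := hηle.trans (min_le_right _ _)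
  have hηη₀ : η ≤ η₀ := hηle.trans (min_le_left _ _)
  obtain ⟨q, hq⟩ : ∃ q, q = y.1 0 ^ 2 + (k * η) ^ 2 * y.1 1 ^ 2 := ⟨_, rfl⟩
  have hkη : 0 < k * η := by positivity
  have hq0 : 0 < q := by
    have hy := y.normSq_pos
    rw [hq]
    rcases (sq_nonneg (y.1 1)).eq_or_lt with h | h
    · rw [← h] at hy ⊢; linarith
    · have := sq_nonneg (y.1 0); positivity
  obtain ⟨r, hr⟩ : ∃ r, r = Real.sqrt q := ⟨_, rfl⟩
  have hr0 : 0 < r := by rw [hr]; exact Real.sqrt_pos.2 hq0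
  have hr2 : r ^ 2 = q := by rw [hr]; exact Real.sq_sqrt hq0.le
  obtain ⟨z₁, hz₁⟩ : ∃ z, z = y.1 0 / r := ⟨_, rfl⟩
  obtain ⟨z₂, hz₂⟩ : ∃ z, z = k * η * y.1 1 / r := ⟨_, rfl⟩
  have hy0 : y.1 0 = r * z₁ := by rw [hz₁]; field_simp
  have hy1 : y.1 1 = r * z₂ / (k * η) := by rw [hz₂]; field_simp
  have hz : z₁ ^ 2 + z₂ ^ 2 = 1 := by
    rw [hz₁, hz₂, div_pow, div_pow, ← add_div, hr2, mul_pow, ← hq]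
    exact div_self hq0.ne'
  have hz₁1 : |z₁| ≤ 1 := (sq_le_one_iff_abs_le_one _).1 (by linarith [sq_nonneg z₂])
  have hz₂1 : |z₂| ≤ 1 := (sq_le_one_iff_abs_le_one _).1 (by linarith [sq_nonneg z₁])
  refine ⟨z₁, z₂, hz, fun ς hς P W hP hW y' t ht hy' => ?_⟩
  have hςabs : |ς| = 1 := abs_eq_one_of_mul_self hς
  have hςP : ∀ i j, |ς * P i j| ≤ C := fun i j => by rw [abs_mul, hςabs, one_mul]; exact hP i j
  have hςη : (ς * η ^ 2) ^ 2 = η ^ 4 := by linear_combination η ^ 4 * hς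
  rw [hςη] at hW
  have h00 := hW 0 0
  have h01 := hW 0 1
  have h10 := hW 1 0
  have h11 := hW 1 1
  simp at h00 h01 h10 h11
  have h10' : |W 1 0| ≤ 2 * C * η ^ 2 := by
    have e1 := abs_le.1 h10
    have e2 := abs_le.1 (hςP 1 0)
    have e3 : C * η ^ 4 ≤ C * η ^ 2 :=
      mul_le_mul_of_nonneg_left (pow_le_pow_of_le_one hη.le hη1 (by norm_num)) hC0.le
    have e4 := mul_le_mul_of_nonneg_right e2.1 (sq_nonneg η)
    have e5 := mul_le_mul_of_nonneg_right e2.2 (sq_nonneg η)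
    exact abs_le.2 ⟨by linarith, by linarith⟩
  obtain ⟨f₁, hf₁⟩ : ∃ f, f = ((W 0 0 - 1 - ς * η ^ 2 * P 0 0) * z₁ +
    (W 0 1 - ς * η ^ 2 * P 0 1) / (k * η) * z₂) / η ^ 3 := ⟨_, rfl⟩
  obtain ⟨f₂, hf₂⟩ : ∃ f, f = (k * η * W 1 0 * z₁ +
    (W 1 1 - 1 - ς * η ^ 2 * P 1 1) * z₂) / η ^ 3 := ⟨_, rfl⟩
  have hf₁C : |f₁| ≤ C' := by
    rw [hf₁]
    exact (abs_add_div_le_of_remainder hη hη1 hk hC0.le h00 h01 hz₁1 hz₂1).trans hf₁'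
  have hf₂C : |f₂| ≤ C' := by
    rw [hf₂]
    exact (abs_add_div_le_of_offDiagonal hη hη1 hk hC0.le h10' h11 hz₁1 hz₂1).trans hf₂'
  have haC : |ς * P 0 1 / k| ≤ C' := by
    rw [abs_div, abs_of_pos hk]
    exact le_trans (by gcongr; exact hςP 0 1) hCk
  have key := hexp η (ς * P 0 1 / k) (ς * P 0 0) (ς * P 1 1) f₁ f₂ z₁ z₂ hη.le hηη₀ haC
    ((hςP 0 0).trans hCC') ((hςP 1 1).trans hCC') hf₁C hf₂C hz
    (W 0 0 * z₁ + W 0 1 / (k * η) * z₂) (k * η * W 1 0 * z₁ + W 1 1 * z₂)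
    (by rw [hf₁]; field_simp; ring) (by rw [hf₂]; field_simp; ring)
  have hsq : (ς * P 0 1 / k) ^ 2 = P 0 1 ^ 2 / k ^ 2 := by
    rw [div_pow, mul_pow, sq ς, hς, one_mul]
  rw [hsq] at key
  obtain ⟨w₁, hw₁⟩ : ∃ w, w = W 0 0 * z₁ + W 0 1 / (k * η) * z₂ := ⟨_, rfl⟩
  obtain ⟨w₂, hw₂⟩ : ∃ w, w = k * η * W 1 0 * z₁ + W 1 1 * z₂ := ⟨_, rfl⟩
  rw [← hw₁, ← hw₂] at key
  have e0 : y'.1 0 ^ 2 = q * w₁ ^ 2 := by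
    rw [hy' 0, hy0, hy1, hw₁, ← hr2]
    linear_combination (r ^ 2 * (W 0 0 * z₁ + W 0 1 / (k * η) * z₂) ^ 2) * ht
  have e1 : (k * η) ^ 2 * y'.1 1 ^ 2 = q * w₂ ^ 2 := by
    have : k * η * y'.1 1 = t * r * w₂ := by rw [hy' 1, hy0, hy1, hw₂]; field_simp
    rw [← mul_pow, this, ← hr2]
    linear_combination (r ^ 2 * w₂ ^ 2) * ht
  have e2 : (k * η) ^ 2 * y.1 1 ^ 2 = q * z₂ ^ 2 := by
    rw [hz₂, ← hr2]; field_simp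
  have hw0 : 0 < w₁ ^ 2 + w₂ ^ 2 := by
    have hy'0 := y'.normSq_pos
    by_contra! h
    have a1 : w₁ ^ 2 = 0 := by linarith [sq_nonneg w₁, sq_nonneg w₂]
    have a2 : w₂ ^ 2 = 0 := by linarith [sq_nonneg w₁, sq_nonneg w₂]
    rw [a1, mul_zero] at e0
    rw [a2, mul_zero] at e1
    have a3 : y'.1 1 ^ 2 = 0 := (mul_eq_zero.1 e1).resolve_left (by positivity)
    rw [e0, a3] at hy'0
    norm_num at hy'0
  refine key.trans (le_of_eq ?_)
  unfold adaptedLog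
  rw [← hq, e0, e1, e2, ← mul_add, Real.log_mul hq0.ne' hw0.ne', mul_div_mul_left _ _ hq0.ne',
    mul_div_cancel_left₀ _ hq0.ne']
  ring

-- Only an upper bound is needed, so log x ≤ x - 1 suffices and no rescaling is required.
set_option maxHeartbeats 600000 in
lemma exists_logNorm_step (C : ℝ) (hC : 1 ≤ C) :
    ∃ B, 0 ≤ B ∧ ∀ y : NonzeroVec, ∃ z₁ z₂ : ℝ,
      z₁ ^ 2 + z₂ ^ 2 = 1 ∧ ∀ l : ℝ, |l| ≤ 1 → ∀ P W : Matrix (Fin 2) (Fin 2) ℝ,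
      (∀ i j, |P i j| ≤ C) → (∀ i j, |(W - 1 - l • P) i j| ≤ C * l ^ 2) →
      ∀ (y' : NonzeroVec) (t : ℝ), t * t = 1 →
      (∀ i, y'.1 i = t * (W i 0 * y.1 0 + W i 1 * y.1 1)) →
      logNorm y' - logNorm y ≤
        l * (P 0 0 * z₁ ^ 2 + (P 0 1 + P 1 0) * (z₁ * z₂) + P 1 1 * z₂ ^ 2) + B * l ^ 2 := by
  -- 4C, at most 4C², from the inner product of z with the Taylor remainder, and 16C² from the
  -- squared displacement.
  refine ⟨20 * C ^ 2, by positivity, fun y => ?_⟩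
  have hC0 : 0 < C := by linarith
  obtain ⟨q, hq⟩ : ∃ q, q = y.1 0 ^ 2 + y.1 1 ^ 2 := ⟨_, rfl⟩
  have hq0 : 0 < q := hq ▸ y.normSq_pos
  obtain ⟨r, hr⟩ : ∃ r, r = Real.sqrt q := ⟨_, rfl⟩
  have hr0 : 0 < r := by rw [hr]; exact Real.sqrt_pos.2 hq0
  have hr2 : r ^ 2 = q := by rw [hr]; exact Real.sq_sqrt hq0.le
  obtain ⟨z₁, hz₁⟩ : ∃ z, z = y.1 0 / r := ⟨_, rfl⟩
  obtain ⟨z₂, hz₂⟩ : ∃ z, z = y.1 1 / r := ⟨_, rfl⟩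
  have hy0 : y.1 0 = r * z₁ := by rw [hz₁]; field_simp
  have hy1 : y.1 1 = r * z₂ := by rw [hz₂]; field_simp
  have hz : z₁ ^ 2 + z₂ ^ 2 = 1 := by
    rw [hz₁, hz₂, div_pow, div_pow, ← add_div, hr2, ← hq]
    exact div_self hq0.ne'
  have hz₁1 : |z₁| ≤ 1 := (sq_le_one_iff_abs_le_one _).1 (by linarith [sq_nonneg z₂])
  have hz₂1 : |z₂| ≤ 1 := (sq_le_one_iff_abs_le_one _).1 (by linarith [sq_nonneg z₁])
  refine ⟨z₁, z₂, hz, fun l hl P W hP hW y' t ht hy' => ?_⟩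
  have hl2 : l ^ 2 ≤ |l| := by rw [← sq_abs]; nlinarith [abs_nonneg l]
  have hrow : ∀ a b z z' : ℝ, |a| ≤ C * l ^ 2 → |b| ≤ C * l ^ 2 → |z| ≤ 1 → |z'| ≤ 1 →
      |a * z + b * z'| ≤ 2 * C * l ^ 2 := by
    intro a b z z' ha hb hz hz'
    refine (abs_add_le _ _).trans ?_
    rw [abs_mul, abs_mul]
    have := mul_le_mul ha hz (abs_nonneg _) (by positivity)
    have := mul_le_mul hb hz' (abs_nonneg _) (by positivity)
    linarith
  have hprow : ∀ a b z z' : ℝ, |a| ≤ C → |b| ≤ C → |z| ≤ 1 → |z'| ≤ 1 →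
      |l * (a * z + b * z')| ≤ 2 * C * |l| := by
    intro a b z z' ha hb hz hz'
    rw [abs_mul]
    have h1 : |a * z + b * z'| ≤ 2 * C := by
      refine (abs_add_le _ _).trans ?_
      rw [abs_mul, abs_mul]
      have := mul_le_mul ha hz (abs_nonneg _) (by positivity)
      have := mul_le_mul hb hz' (abs_nonneg _) (by positivity)
      linarith
    have := mul_le_mul_of_nonneg_left h1 (abs_nonneg l)
    linarith
  have h00 := hW 0 0
  have h01 := hW 0 1
  have h10 := hW 1 0
  have h11 := hW 1 1
  simp at h00 h01 h10 h11
  obtain ⟨p₁, hp₁⟩ : ∃ e, e = P 0 0 * z₁ + P 0 1 * z₂ := ⟨_, rfl⟩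
  obtain ⟨p₂, hp₂⟩ : ∃ e, e = P 1 0 * z₁ + P 1 1 * z₂ := ⟨_, rfl⟩
  obtain ⟨e₁, he₁⟩ : ∃ e, e = (W 0 0 - 1 - l * P 0 0) * z₁ + (W 0 1 - l * P 0 1) * z₂ := ⟨_, rfl⟩
  obtain ⟨e₂, he₂⟩ : ∃ e, e = (W 1 0 - l * P 1 0) * z₁ + (W 1 1 - 1 - l * P 1 1) * z₂ := ⟨_, rfl⟩
  have he₁C : |e₁| ≤ 2 * C * l ^ 2 := he₁ ▸ hrow _ _ _ _ h00 h01 hz₁1 hz₂1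
  have he₂C : |e₂| ≤ 2 * C * l ^ 2 := he₂ ▸ hrow _ _ _ _ h10 h11 hz₁1 hz₂1
  have hp₁C : |l * p₁| ≤ 2 * C * |l| := hp₁ ▸ hprow _ _ _ _ (hP 0 0) (hP 0 1) hz₁1 hz₂1
  have hp₂C : |l * p₂| ≤ 2 * C * |l| := hp₂ ▸ hprow _ _ _ _ (hP 1 0) (hP 1 1) hz₁1 hz₂1
  have hsum : ∀ u e : ℝ, |u| ≤ 2 * C * |l| → |e| ≤ 2 * C * l ^ 2 →
      (u + e) ^ 2 ≤ 16 * C ^ 2 * l ^ 2 := by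
    intro u e hu he
    have h1 : |u + e| ≤ 4 * C * |l| := by
      refine (abs_add_le _ _).trans ?_
      have := mul_le_mul_of_nonneg_left hl2 hC0.le
      linarith
    calc (u + e) ^ 2 = |u + e| ^ 2 := (sq_abs _).symm
      _ ≤ (4 * C * |l|) ^ 2 := by gcongr
      _ = 16 * C ^ 2 * l ^ 2 := by rw [mul_pow, sq_abs]; ring
  have s1 := hsum _ _ hp₁C he₁C
  have s2 := hsum _ _ hp₂C he₂C
  have he : z₁ * e₁ + z₂ * e₂ ≤ 4 * C * l ^ 2 := by
    have a1 : z₁ * e₁ ≤ 2 * C * l ^ 2 := by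
      refine (le_abs_self _).trans ?_
      rw [abs_mul]
      have := mul_le_mul hz₁1 he₁C (abs_nonneg _) zero_le_one
      linarith
    have a2 : z₂ * e₂ ≤ 2 * C * l ^ 2 := by
      refine (le_abs_self _).trans ?_
      rw [abs_mul]
      have := mul_le_mul hz₂1 he₂C (abs_nonneg _) zero_le_one
      linarith
    linarith
  obtain ⟨w₁, hw₁⟩ : ∃ w, w = z₁ + (l * p₁ + e₁) := ⟨_, rfl⟩
  obtain ⟨w₂, hw₂⟩ : ∃ w, w = z₂ + (l * p₂ + e₂) := ⟨_, rfl⟩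
  have k0 : y'.1 0 = t * r * w₁ := by rw [hy' 0, hy0, hy1, hw₁, hp₁, he₁]; ring
  have k1 : y'.1 1 = t * r * w₂ := by rw [hy' 1, hy0, hy1, hw₂, hp₂, he₂]; ring
  have hq' : y'.1 0 ^ 2 + y'.1 1 ^ 2 = q * (w₁ ^ 2 + w₂ ^ 2) := by
    rw [k0, k1, ← hr2]; linear_combination (r ^ 2 * (w₁ ^ 2 + w₂ ^ 2)) * ht
  have hw0 : 0 < w₁ ^ 2 + w₂ ^ 2 := by
    have := y'.normSq_pos
    rw [hq'] at this
    exact pos_of_mul_pos_right this hq0.le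
  unfold logNorm
  rw [hq', ← hq, Real.log_mul hq0.ne' hw0.ne']
  have hlog := Real.log_le_sub_one_of_pos hw0
  have hexp : w₁ ^ 2 + w₂ ^ 2 - 1 = 2 * l * (z₁ * p₁ + z₂ * p₂) + 2 * (z₁ * e₁ + z₂ * e₂) +
      (l * p₁ + e₁) ^ 2 + (l * p₂ + e₂) ^ 2 := by
    rw [hw₁, hw₂]; linear_combination hz
  have hzp : z₁ * p₁ + z₂ * p₂ =
      P 0 0 * z₁ ^ 2 + (P 0 1 + P 1 0) * (z₁ * z₂) + P 1 1 * z₂ ^ 2 := by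
    rw [hp₁, hp₂]; ring
  rw [← hzp]
  have hCC : C ≤ C ^ 2 := by nlinarith
  have := mul_le_mul_of_nonneg_right hCC (sq_nonneg l)
  linarith

/-- With t = z₂², the right side is 1 + t(19/2 - 20t + 12t²), whose quadratic factor has negative
discriminant. The logarithm alone would give 1 - 5t/2 + t², negative at t = 1; the correction with
coefficient 3 in `adaptedLog` repairs this and leaves the value 1 at t = 0 unchanged. -/
lemma one_le_drift_polynomial {z₁ z₂ : ℝ} (hz : z₁ ^ 2 + z₂ ^ 2 = 1) :
    1 ≤ (z₂ ^ 2 / 2 - z₁ ^ 2 * z₂ ^ 2 + 3 * z₂ ^ 4 - 12 * z₁ ^ 2 * z₂ ^ 4) +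
      (z₁ ^ 2 + 6 * z₁ ^ 2 * z₂ ^ 2) - (z₂ ^ 2 - 6 * z₁ ^ 2 * z₂ ^ 2) := by
  obtain ⟨t, ht⟩ : ∃ t, t = z₂ ^ 2 := ⟨_, rfl⟩
  have h1 : z₁ ^ 2 = 1 - t := by rw [ht]; linarith
  have h4 : z₂ ^ 4 = t ^ 2 := by rw [ht]; ring
  rw [h4, h1, ← ht]
  have ht0 : 0 ≤ t := by rw [ht]; positivity
  have : 0 ≤ 19 / 2 - 20 * t + 12 * t ^ 2 := by nlinarith [sq_nonneg (t - 5 / 6)]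
  nlinarith [mul_nonneg ht0 this]

/-! ### Averaging the increments: asymptotics for λμ > 0 -/

lemma meanP_apply {Ω : Type*} [MeasurableSpace Ω] (p : Measure Ω) (T : ℝ → Ω → SL(2, ℝ))
    (M : SL(2, ℝ)) (i j : Fin 2) : meanP p T M i j = ∫ σ, firstOrderP T M σ i j ∂p := rfl

lemma measurable_slAct_const (M : SL(2, ℝ)) : Measurable (slAct M) :=
  (measurable_slAct (Ω := Unit) (τ := fun _ => M) fun _ _ => measurable_const).comp
    (measurable_const.prodMk measurable_id : Measurable fun x => ((), x))

lemma integral_affine_comb {Ω : Type*} [MeasurableSpace Ω] {p : Measure Ω}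
    [IsProbabilityMeasure p] {f₁ f₂ f₃ f₄ : Ω → ℝ} (h₁ : Integrable f₁ p) (h₂ : Integrable f₂ p)
    (h₃ : Integrable f₃ p) (h₄ : Integrable f₄ p) (c₁ c₂ c₃ c₄ c₅ : ℝ) :
    Integrable (fun σ => f₁ σ * c₁ + f₂ σ * c₂ + f₃ σ * c₃ + f₄ σ * c₄ + c₅) p ∧
    ∫ σ, (f₁ σ * c₁ + f₂ σ * c₂ + f₃ σ * c₃ + f₄ σ * c₄ + c₅) ∂p =
      (∫ σ, f₁ σ ∂p) * c₁ + (∫ σ, f₂ σ ∂p) * c₂ + (∫ σ, f₃ σ ∂p) * c₃ +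
        (∫ σ, f₄ σ ∂p) * c₄ + c₅ := by
  have i1 := h₁.mul_const c₁
  have i2 : Integrable (fun σ => f₁ σ * c₁ + f₂ σ * c₂) p := i1.add (h₂.mul_const c₂)
  have i3 : Integrable (fun σ => f₁ σ * c₁ + f₂ σ * c₂ + f₃ σ * c₃) p :=
    i2.add (h₃.mul_const c₃)
  have i4 : Integrable (fun σ => f₁ σ * c₁ + f₂ σ * c₂ + f₃ σ * c₃ + f₄ σ * c₄) p :=
    i3.add (h₄.mul_const c₄)
  refine ⟨i4.add (integrable_const _), ?_⟩
  rw [integral_add i4 (integrable_const _), integral_add i3 (h₄.mul_const c₄),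
    integral_add i2 (h₃.mul_const c₃), integral_add i1 (h₂.mul_const c₂)]
  simp [integral_mul_const]

lemma integrable_increment {Ω : Type*} [MeasurableSpace Ω] {p : Measure Ω} [IsProbabilityMeasure p]
    {τ : Ω → SL(2, ℝ)} (hτ : ∀ i j : Fin 2, Measurable fun σ => τ σ i j) {C : ℝ}
    (hC : ∀ᵐ σ ∂p, ∀ i j : Fin 2, |τ σ i j| ≤ C) {H : NonzeroVec → ℝ} (hH : Measurable H) {K : ℝ}
    (hK : ∀ y, |H y - logNorm y| ≤ K) (y : NonzeroVec) :
    Integrable (fun σ => H (slAct (τ σ) y) - H y) p := by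
  refine Integrable.of_bound ((hH.comp ((measurable_slAct hτ).comp
    (measurable_id.prodMk measurable_const))).sub measurable_const).aestronglyMeasurable
    (Real.log (4 * C ^ 2) / 2 + 2 * K) (hC.mono fun σ h => ?_)
  have h1 := abs_le.1 (abs_logNorm_slAct_sub_le h y)
  have h2 := abs_le.1 (hK y)
  have h3 := abs_le.1 (hK (slAct (τ σ) y))
  exact abs_le.2 ⟨by linarith, by linarith⟩

theorem lyapunov_asymptotics_of_noise {Ω : Type*} [MeasurableSpace Ω] {p : Measure Ω}
    [IsProbabilityMeasure p] {T : ℝ → Ω → SL(2, ℝ)} (hT : IsSmoothRandomFamily p T)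
    (hA : IsFirstOrderAnomaly T) (M : SL(2, ℝ)) (μ : ℝ)
    (hmean : meanP p T M = Matrix.diagonal ![μ / 2, -(μ / 2)])
    (hnoise : ¬ ∀ᵐ σ ∂p, firstOrderP T M σ 0 1 = 0) :
    ∃ C > 0, ∃ ε > 0, ∀ l : ℝ, |l| < ε → 0 < l * μ →
      ∃ γ : ℝ, HasLyapunovExponent p T l γ ∧ |γ - |l * μ| / 2| ≤ C * |l| ^ (3 / 2 : ℝ) := by
  by_cases hμ : μ = 0
  · exact ⟨1, one_pos, 1, one_pos, fun l _ h => by simp [hμ] at h⟩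
  obtain ⟨β, hβ⟩ : ∃ β, β = |μ| / 2 := ⟨_, rfl⟩
  have hβ0 : 0 < β := by rw [hβ]; positivity
  obtain ⟨C, hC1, hC⟩ := exists_uniform_bound hT hA M
  have hPi := integrable_firstOrderP hT hA M
  have m00 : ∫ σ, firstOrderP T M σ 0 0 ∂p = μ / 2 := by rw [← meanP_apply, hmean]; simp
  have m01 : ∫ σ, firstOrderP T M σ 0 1 ∂p = 0 := by rw [← meanP_apply, hmean]; simp
  have m10 : ∫ σ, firstOrderP T M σ 1 0 ∂p = 0 := by rw [← meanP_apply, hmean]; simp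
  have m11 : ∫ σ, firstOrderP T M σ 1 1 ∂p = -(μ / 2) := by rw [← meanP_apply, hmean]; simp
  have hP2 : Integrable (fun σ => firstOrderP T M σ 0 1 ^ 2) p :=
    Integrable.of_bound ((measurable_firstOrderP hT M 0 1).pow_const 2).aestronglyMeasurable
      (C ^ 2) (hC.mono fun σ h => by
        rw [Real.norm_eq_abs, abs_pow]
        have := h.1 0 1
        gcongr)
  obtain ⟨V, hV⟩ : ∃ V, V = ∫ σ, firstOrderP T M σ 0 1 ^ 2 ∂p := ⟨_, rfl⟩
  have hV0 : 0 < V := by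
    refine lt_of_le_of_ne (by rw [hV]; exact integral_nonneg fun σ => sq_nonneg _) fun h => ?_
    rw [hV] at h
    apply hnoise
    filter_upwards [(integral_eq_zero_iff_of_nonneg (fun σ => sq_nonneg _) hP2).1 h.symm] with σ hσ
    simpa using hσ
  -- This k makes the variance V / k² of the rescaled noise equal to the drift β, so that a single
  -- polynomial controls both.
  obtain ⟨k, hk⟩ : ∃ k, k = Real.sqrt (V / β) := ⟨_, rfl⟩
  have hk0 : 0 < k := by rw [hk]; exact Real.sqrt_pos.2 (by positivity)
  have hk2 : V / k ^ 2 = β := by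
    rw [hk, Real.sq_sqrt (by positivity)]; field_simp
  obtain ⟨B, hB0, η₀, hη₀, hstep⟩ := exists_adaptedLog_step C hC1 k hk0
  obtain ⟨B', hB'0, hstep'⟩ := exists_logNorm_step C hC1
  obtain ⟨m, hm⟩ := exists_entry_bound M
  -- The three bounds on |l| give, in turn, the Taylor estimates, η ≤ η₀, and a positive drift η²β -
  -- Bη³.
  refine ⟨B + B' + 1, by positivity, min 1 (min (η₀ ^ 2) ((β / (B + 1)) ^ 2)), by positivity,
    fun l hl hlμ => ?_⟩
  obtain ⟨η, hη⟩ : ∃ η, η = Real.sqrt |l| := ⟨_, rfl⟩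
  have hl0 : l ≠ 0 := fun h => by simp [h] at hlμ
  have hη0 : 0 < η := by rw [hη]; exact Real.sqrt_pos.2 (abs_pos.2 hl0)
  have hη2 : η ^ 2 = |l| := by rw [hη]; exact Real.sq_sqrt (abs_nonneg l)
  have hl1 : |l| ≤ 1 := hl.le.trans (min_le_left _ _)
  have hη1 : η ≤ 1 := by rw [hη]; exact Real.sqrt_le_one.2 hl1
  have hηη₀ : η ≤ η₀ := by
    rw [hη]
    exact Real.sqrt_le_iff.2 ⟨hη₀.le, hl.le.trans ((min_le_right _ _).trans (min_le_left _ _))⟩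
  have hηβ : η < β / (B + 1) := by
    rw [hη]
    exact (Real.sqrt_lt' (by positivity)).2
      (hl.trans_le ((min_le_right _ _).trans (min_le_right _ _)))
  have hη3 : |l| ^ (3 / 2 : ℝ) = η ^ 3 := by
    rw [← hη2, ← Real.rpow_natCast η 2, ← Real.rpow_mul hη0.le, ← Real.rpow_natCast η 3]
    norm_num
  obtain ⟨ς, hς, hlς⟩ : ∃ ς : ℝ, ς * ς = 1 ∧ l = ς * η ^ 2 := by
    rcases le_or_gt 0 l with h | h
    · exact ⟨1, by norm_num, by rw [hη2, abs_of_nonneg h, one_mul]⟩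
    · exact ⟨-1, by norm_num, by rw [hη2, abs_of_neg h]; ring⟩
  have hlβ : l * (μ / 2) = η ^ 2 * β := by
    rw [hβ, hη2, ← mul_div_assoc, ← mul_div_assoc, ← abs_mul, abs_of_pos hlμ]
  have hςμ : ς * (μ / 2) = β := by
    have : η ^ 2 * (ς * (μ / 2)) = η ^ 2 * β := by rw [← hlβ, hlς]; ring
    exact mul_left_cancel₀ (by positivity) this
  have hs0 : 0 < (k * η) ^ 2 := by positivity
  have hTb : ∀ᵐ σ ∂p, ∀ i j : Fin 2, |T l σ i j| ≤ C := hC.mono fun σ h => (h.2 l hl1).1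
  have hMlog : ∀ y, |logNorm (slAct M y) - logNorm y| ≤ Real.log (4 * m ^ 2) / 2 :=
    abs_logNorm_slAct_sub_le hm
  obtain ⟨K, hK⟩ : ∃ K, K = Real.log (4 * m ^ 2) / 2 +
    |Real.log (1 + (k * η) ^ 2 + 1 / (k * η) ^ 2) / 2 + 3| := ⟨_, rfl⟩
  have hFK : ∀ y, |adaptedLog ((k * η) ^ 2) (slAct M y) - logNorm y| ≤ K := fun y => by
    have h1 := abs_le.1 ((abs_adaptedLog_sub_le hs0 (slAct M y)).trans (le_abs_self _))
    have h2 := abs_le.1 (hMlog y)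
    rw [hK]
    exact abs_le.2 ⟨by linarith, by linarith⟩
  have hGK : ∀ y, |logNorm (slAct M y) - logNorm y| ≤ K := fun y =>
    (hMlog y).trans (by rw [hK]; exact le_add_of_nonneg_right (abs_nonneg _))
  have hFm : Measurable fun y => adaptedLog ((k * η) ^ 2) (slAct M y) :=
    (measurable_adaptedLog _).comp (measurable_slAct_const M)
  have hGm : Measurable fun y => logNorm (slAct M y) :=
    measurable_logNorm.comp (measurable_slAct_const M)
  have hc : 0 < η ^ 2 * β - B * η ^ 3 := by
    rw [lt_div_iff₀ (by positivity)] at hηβ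
    have : 0 < β - B * η := by linarith
    have := mul_pos (pow_pos hη0 2) this
    linarith
  have hdrift : ∀ y, η ^ 2 * β - B * η ^ 3 ≤ meanIncrement p (fun σ => slAct (T l σ))
      (fun y => adaptedLog ((k * η) ^ 2) (slAct M y)) y := by
    intro y
    obtain ⟨z₁, z₂, hz, hlow⟩ := hstep η hη0 hηη₀ (slAct M y)
    obtain ⟨c₁, hc₁⟩ : ∃ c, c = z₁ * z₂ + 6 * z₁ * z₂ ^ 3 := ⟨_, rfl⟩
    obtain ⟨c₂, hc₂⟩ : ∃ c, c = z₂ ^ 2 / 2 - z₁ ^ 2 * z₂ ^ 2 + 3 * z₂ ^ 4 -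
      12 * z₁ ^ 2 * z₂ ^ 4 := ⟨_, rfl⟩
    obtain ⟨c₃, hc₃⟩ : ∃ c, c = z₁ ^ 2 + 6 * z₁ ^ 2 * z₂ ^ 2 := ⟨_, rfl⟩
    obtain ⟨c₄, hc₄⟩ : ∃ c, c = z₂ ^ 2 - 6 * z₁ ^ 2 * z₂ ^ 2 := ⟨_, rfl⟩
    have hpoly := one_le_drift_polynomial hz
    rw [← hc₂, ← hc₃, ← hc₄] at hpoly
    rw [← hc₁, ← hc₂, ← hc₃, ← hc₄] at hlow
    obtain ⟨hint, hval⟩ := integral_affine_comb (hPi 0 1) hP2 (hPi 0 0) (hPi 1 1)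
      (η * ς / k * c₁) (η ^ 2 / k ^ 2 * c₂) (η ^ 2 * ς * c₃) (η ^ 2 * ς * c₄) (-(B * η ^ 3))
    have hae : ∀ᵐ σ ∂p, firstOrderP T M σ 0 1 * (η * ς / k * c₁) +
        firstOrderP T M σ 0 1 ^ 2 * (η ^ 2 / k ^ 2 * c₂) +
        firstOrderP T M σ 0 0 * (η ^ 2 * ς * c₃) +
        firstOrderP T M σ 1 1 * (η ^ 2 * ς * c₄) + -(B * η ^ 3) ≤
        adaptedLog ((k * η) ^ 2) (slAct M (slAct (T l σ) y)) -
          adaptedLog ((k * η) ^ 2) (slAct M y) := by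
      filter_upwards [hC] with σ hσ
      obtain ⟨t, ht, hy'⟩ := slAct_conj hA M l σ y
      have := hlow ς hς (firstOrderP T M σ) (conjTransfer T M l σ) hσ.1
        (by rw [← hlς]; exact (hσ.2 l hl1).2) _ t ht hy'
      refine le_trans (le_of_eq ?_) this
      ring
    refine le_trans ?_ (integral_mono_ae hint
      (integrable_increment (hT.measurable l) hTb hFm hFK y) hae)
    rw [hval, m00, m01, m11, ← hV]
    -- The order η term disappears because the noise `P 0 1` is centered; what remains is the drift
    -- polynomial times η²β.
    have hval' : 0 * (η * ς / k * c₁) + V * (η ^ 2 / k ^ 2 * c₂) + μ / 2 * (η ^ 2 * ς * c₃) +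
        -(μ / 2) * (η ^ 2 * ς * c₄) + -(B * η ^ 3) =
        η ^ 2 * β * (c₂ + c₃ - c₄) - B * η ^ 3 := by
      linear_combination (η ^ 2 * c₂) * hk2 + (η ^ 2 * (c₃ - c₄)) * hςμ
    rw [hval']
    have := mul_le_mul_of_nonneg_left hpoly (mul_nonneg (sq_nonneg η) hβ0.le)
    linarith
  have hdrift' : ∀ y, meanIncrement p (fun σ => slAct (T l σ))
      (fun y => logNorm (slAct M y)) y ≤ η ^ 2 * β + B' * l ^ 2 := by
    intro y
    obtain ⟨z₁, z₂, hz, hup⟩ := hstep' (slAct M y)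
    obtain ⟨hint, hval⟩ := integral_affine_comb (hPi 0 0) (hPi 0 1) (hPi 1 0) (hPi 1 1)
      (l * z₁ ^ 2) (l * (z₁ * z₂)) (l * (z₁ * z₂)) (l * z₂ ^ 2) (B' * l ^ 2)
    have hae : ∀ᵐ σ ∂p, logNorm (slAct M (slAct (T l σ) y)) - logNorm (slAct M y) ≤
        firstOrderP T M σ 0 0 * (l * z₁ ^ 2) + firstOrderP T M σ 0 1 * (l * (z₁ * z₂)) +
        firstOrderP T M σ 1 0 * (l * (z₁ * z₂)) +
        firstOrderP T M σ 1 1 * (l * z₂ ^ 2) + B' * l ^ 2 := by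
      filter_upwards [hC] with σ hσ
      obtain ⟨t, ht, hy'⟩ := slAct_conj hA M l σ y
      refine (hup l hl1 (firstOrderP T M σ) (conjTransfer T M l σ) hσ.1
        (hσ.2 l hl1).2 _ t ht hy').trans (le_of_eq ?_)
      ring
    refine (integral_mono_ae (integrable_increment (hT.measurable l) hTb hGm hGK y)
      hint hae).trans ?_
    rw [hval, m00, m01, m10, m11]
    have h1 : z₁ ^ 2 - z₂ ^ 2 ≤ 1 := by linarith [sq_nonneg z₂]
    have := mul_le_mul_of_nonneg_left h1 (mul_nonneg (sq_nonneg η) hβ0.le)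
    rw [← hlβ] at this ⊢
    linarith
  obtain ⟨γ, hγ, hγ1, hγ2⟩ := exists_hasLyapunovExponent (p := p) (T := T) (l := l)
    (hT.measurable l) hTb hFm hGm hFK hGK hc hdrift hdrift'
  refine ⟨γ, hγ, ?_⟩
  have h1 : |l * μ| / 2 = η ^ 2 * β := by rw [← hlβ, abs_of_pos hlμ]; ring
  have h2 : l ^ 2 ≤ η ^ 3 := by
    rw [← sq_abs, ← hη2, ← pow_mul]
    exact pow_le_pow_of_le_one hη0.le hη1 (by norm_num)
  have h3 := mul_le_mul_of_nonneg_left h2 hB'0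
  have h4 : 0 < η ^ 3 := by positivity
  have h5 := mul_nonneg hB'0 h4.le
  have h6 := mul_nonneg hB0 h4.le
  rw [h1, hη3]
  exact abs_le.2 ⟨by linarith, by linarith⟩

/-! ### The perturbation at the fixed angles, and exchange of the axes -/

lemma alphaCoeff_im (P : Matrix (Fin 2) (Fin 2) ℝ) :
    (alphaCoeff P).im = (P 1 0 - P 0 1) / 2 := by
  have h2 : (Real.sqrt 2)⁻¹ * (Real.sqrt 2)⁻¹ = 1 / 2 := by
    rw [← mul_inv, Real.mul_self_sqrt (by norm_num)]; norm_num
  unfold alphaCoeff vVec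
  simp [Matrix.mulVec, dotProduct, Fin.sum_univ_two, div_eq_mul_inv, ← Complex.ofReal_inv]
  linear_combination (P 1 0 - P 0 1) * h2

lemma betaCoeff_im (P : Matrix (Fin 2) (Fin 2) ℝ) :
    (betaCoeff P).im = -(P 0 1 + P 1 0) / 2 := by
  have h2 : (Real.sqrt 2)⁻¹ * (Real.sqrt 2)⁻¹ = 1 / 2 := by
    rw [← mul_inv, Real.mul_self_sqrt (by norm_num)]; norm_num
  unfold betaCoeff vVec
  simp [Matrix.mulVec, dotProduct, Fin.sum_univ_two, div_eq_mul_inv, ← Complex.ofReal_inv]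
  linear_combination -(P 1 0 + P 0 1) * h2

/-- The noise hypothesis at angle π/2 thus says exactly that `P 0 1` is not almost surely zero, so
that its second moment is positive. -/
lemma centeredPerturbation_pi_div_two {Ω : Type*} (T : ℝ → Ω → SL(2, ℝ)) (M : SL(2, ℝ)) (μ : ℝ)
    (σ : Ω) : centeredPerturbation T M μ σ (Real.pi / 2) = -firstOrderP T M σ 0 1 := by
  have h : Complex.exp (2 * Complex.I * ((Real.pi / 2 : ℝ) : ℂ)) = -1 := by
    rw [← Complex.exp_pi_mul_I]
    congr 1
    push_cast
    ring
  unfold centeredPerturbation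
  rw [h]
  simp [alphaCoeff_im, betaCoeff_im]
  ring

lemma centeredPerturbation_zero {Ω : Type*} (T : ℝ → Ω → SL(2, ℝ)) (M : SL(2, ℝ)) (μ : ℝ)
    (σ : Ω) : centeredPerturbation T M μ σ 0 = firstOrderP T M σ 1 0 := by
  unfold centeredPerturbation
  simp [alphaCoeff_im, betaCoeff_im]
  ring

/-- The rotation by a quarter turn, which exchanges the two coordinate axes. -/
def quarterTurn : SL(2, ℝ) := ⟨!![0, 1; -1, 0], by simp [Matrix.det_fin_two]⟩

/-- The diagonal entries are exchanged, which turns μ into -μ, and the noise `P 1 0` at angle 0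
takes the place of `P 0 1`. -/
lemma firstOrderP_quarterTurn {Ω : Type*} (T : ℝ → Ω → SL(2, ℝ)) (M : SL(2, ℝ)) (σ : Ω) :
    firstOrderP T (quarterTurn * M) σ =
      !![firstOrderP T M σ 1 1, -firstOrderP T M σ 1 0;
        -firstOrderP T M σ 0 1, firstOrderP T M σ 0 0] := by
  have h : firstOrderP T (quarterTurn * M) σ = (quarterTurn : Matrix (Fin 2) (Fin 2) ℝ) *
      firstOrderP T M σ * ((quarterTurn⁻¹ : SL(2, ℝ)) : Matrix (Fin 2) (Fin 2) ℝ) := by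
    unfold firstOrderP
    rw [mul_inv_rev, Matrix.SpecialLinearGroup.coe_mul, Matrix.SpecialLinearGroup.coe_mul]
    simp only [Matrix.mul_assoc]
  rw [h, Matrix.SpecialLinearGroup.coe_inv, Matrix.adjugate_fin_two]
  ext i j
  fin_cases i <;> fin_cases j <;> simp [quarterTurn, Matrix.mul_apply,
    Matrix.vecMul, dotProduct, Fin.sum_univ_two]

lemma meanP_quarterTurn {Ω : Type*} [MeasurableSpace Ω] {p : Measure Ω}
    {T : ℝ → Ω → SL(2, ℝ)} {M : SL(2, ℝ)} {μ : ℝ}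
    (h : meanP p T M = Matrix.diagonal ![μ / 2, -(μ / 2)]) :
    meanP p T (quarterTurn * M) = Matrix.diagonal ![-μ / 2, -(-μ / 2)] := by
  have h' : ∀ i j, ∫ σ, firstOrderP T M σ i j ∂p =
      (Matrix.diagonal ![μ / 2, -(μ / 2)] : Matrix (Fin 2) (Fin 2) ℝ) i j := fun i j => by
    rw [← meanP_apply, h]
  ext i j
  rw [meanP_apply]
  simp only [firstOrderP_quarterTurn]
  fin_cases i <;> fin_cases j <;> simp [integral_neg, h'] <;> ring

/-! ### Normal form of the mean, and the main theorem -/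

/-- A is traceless with eigenvalues ±ν, ν = √(-det A). The rows of M are left eigenvectors, scaled
to determinant one, and μ = 2ν. -/
lemma exists_diagonalization {A : Matrix (Fin 2) (Fin 2) ℝ} (htr : A 0 0 + A 1 1 = 0)
    (hdet : A.det < 0) : ∃ (M : SL(2, ℝ)) (μ : ℝ), 0 < μ ∧
      (M : Matrix (Fin 2) (Fin 2) ℝ) * A = Matrix.diagonal ![μ / 2, -(μ / 2)] * M := by
  obtain ⟨ν, hν⟩ : ∃ ν, ν = Real.sqrt (-A.det) := ⟨_, rfl⟩
  have hν0 : 0 < ν := by rw [hν]; exact Real.sqrt_pos.2 (by linarith)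
  have h11 : A 1 1 = -A 0 0 := by linarith
  have hν2 : ν ^ 2 = A 0 0 ^ 2 + A 0 1 * A 1 0 := by
    rw [hν, Real.sq_sqrt (by linarith), Matrix.det_fin_two, h11]; ring
  -- Each eigenvector has two natural formulas; the sign of `A 0 0` selects those containing ν + |`A
  -- 0 0`|, which cannot vanish.
  rcases le_or_gt 0 (A 0 0) with ha | ha
  · have hd : 2 * ν * (ν + A 0 0) ≠ 0 := by positivity
    refine ⟨⟨!![(ν + A 0 0) / (2 * ν * (ν + A 0 0)), A 0 1 / (2 * ν * (ν + A 0 0));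
      -A 1 0, ν + A 0 0], ?_⟩, 2 * ν, by positivity, ?_⟩
    · rw [Matrix.det_fin_two]
      simp only [Matrix.of_apply, Matrix.cons_val', Matrix.cons_val_zero, Matrix.cons_val_one,
        Matrix.cons_val_fin_one]
      rw [div_mul_eq_mul_div, div_mul_eq_mul_div, ← sub_div, div_eq_one_iff_eq hd]
      linear_combination -hν2
    · ext i j
      fin_cases i <;> fin_cases j <;> simp [Matrix.mul_apply, Fin.sum_univ_two, h11]
      · rw [div_mul_eq_mul_div, div_mul_eq_mul_div, ← add_div, mul_div_assoc']
        congr 1; linear_combination -hν2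
      · rw [div_mul_eq_mul_div, div_mul_eq_mul_div, neg_div', ← add_div, mul_div_assoc']
        congr 1; ring
      · ring
      · linear_combination hν2
  · have hνa : 0 < ν - A 0 0 := by linarith
    obtain ⟨d, hd⟩ : ∃ d, d = -(2 * ν * (ν - A 0 0)) := ⟨_, rfl⟩
    have hd0 : d ≠ 0 := by
      have : 0 < 2 * ν * (ν - A 0 0) := by positivity
      rw [hd]
      linarith
    refine ⟨⟨!![A 1 0 / d, (ν - A 0 0) / d;
      ν - A 0 0, -A 0 1], ?_⟩, 2 * ν, by positivity, ?_⟩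
    · rw [Matrix.det_fin_two]
      simp only [Matrix.of_apply, Matrix.cons_val', Matrix.cons_val_zero, Matrix.cons_val_one,
        Matrix.cons_val_fin_one]
      rw [div_mul_eq_mul_div, div_mul_eq_mul_div, ← sub_div, div_eq_one_iff_eq hd0]
      linear_combination hν2 - hd
    · ext i j
      fin_cases i <;> fin_cases j <;> simp [Matrix.mul_apply, Fin.sum_univ_two, h11]
      · field_simp; ring
      · field_simp; linear_combination -hν2
      · linear_combination hν2
      · ring

/-- The determinant is constantly 1, and its derivative at ±1 is ± the trace of the derivative. -/
lemma trace_firstOrderP {Ω : Type*} {T : ℝ → Ω → SL(2, ℝ)}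
    (hs : ∀ (σ : Ω) (i j : Fin 2), ContDiff ℝ ∞ fun l => T l σ i j)
    (hA : IsFirstOrderAnomaly T) (σ : Ω) :
    firstOrderP T 1 σ 0 0 + firstOrderP T 1 σ 1 1 = 0 := by
  have hd : ∀ i j, HasDerivAt (fun l => T l σ i j) (derivAtZero T σ i j) 0 := fun i j =>
    ((hs σ i j).differentiable (by simp) 0).hasDerivAt
  have h1 := ((hd 0 0).mul (hd 1 1)).sub ((hd 0 1).mul (hd 1 0))
  have h2 : ((fun l => T l σ 0 0) * (fun l => T l σ 1 1) -
      (fun l => T l σ 0 1) * (fun l => T l σ 1 0)) = fun _ => (1 : ℝ) := by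
    ext l; exact slAct_det (T l σ)
  rw [h2] at h1
  have h3 := h1.unique (hasDerivAt_const _ _)
  obtain ⟨s, hs, hs1, hs2⟩ := coe_inv_of_firstOrder hA σ
  unfold firstOrderP
  rw [hs2]
  simp [hs1] at h3 ⊢
  linarith

theorem mainTheorem3 {Ω : Type*} [MeasurableSpace Ω] (p : Measure Ω) [IsProbabilityMeasure p]
    (T : ℝ → Ω → SL(2, ℝ)) (hT : IsSmoothRandomFamily p T)
    (hA : IsHyperbolicFirstDegreeAnomaly p T) :
    (∃ (M : SL(2, ℝ)) (μ : ℝ), 0 < μ ∧ meanP p T M = Matrix.diagonal ![μ / 2, -(μ / 2)]) ∧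
    ∀ (M : SL(2, ℝ)) (μ : ℝ), meanP p T M = Matrix.diagonal ![μ / 2, -(μ / 2)] →
      ((¬ ∀ᵐ σ ∂p, centeredPerturbation T M μ σ (Real.pi / 2) = 0) →
        ∃ C > 0, ∃ ε > 0, ∀ l : ℝ, |l| < ε → 0 < l * μ →
          ∃ γ : ℝ, HasLyapunovExponent p T l γ ∧
            |γ - |l * μ| / 2| ≤ C * |l| ^ (3 / 2 : ℝ)) ∧
      ((¬ ∀ᵐ σ ∂p, centeredPerturbation T M μ σ 0 = 0) →
        ∃ C > 0, ∃ ε > 0, ∀ l : ℝ, |l| < ε → l * μ < 0 →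
          ∃ γ : ℝ, HasLyapunovExponent p T l γ ∧
            |γ - |l * μ| / 2| ≤ C * |l| ^ (3 / 2 : ℝ)) := by
  refine ⟨?_, fun M μ hmean => ⟨fun hnoise => ?_, fun hnoise => ?_⟩⟩
  · have htr : meanP p T 1 0 0 + meanP p T 1 1 1 = 0 := by
      rw [meanP_apply, meanP_apply, ← integral_add
        (integrable_firstOrderP hT hA.firstOrder 1 0 0)
        (integrable_firstOrderP hT hA.firstOrder 1 1 1)]
      simp [trace_firstOrderP hT.smooth hA.firstOrder]
    obtain ⟨M, μ, hμ, hM⟩ := exists_diagonalization htr hA.hyperbolic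
    refine ⟨M, μ, hμ, ?_⟩
    have h1 : meanP p T M = (M : Matrix (Fin 2) (Fin 2) ℝ) * meanP p T 1 *
        ((M⁻¹ : SL(2, ℝ)) : Matrix (Fin 2) (Fin 2) ℝ) := by
      ext i j
      have hi := integrable_firstOrderP hT hA.firstOrder 1
      have hsum : ∀ P : Matrix (Fin 2) (Fin 2) ℝ, ((M : Matrix (Fin 2) (Fin 2) ℝ) * P *
          ((M⁻¹ : SL(2, ℝ)) : Matrix (Fin 2) (Fin 2) ℝ)) i j =
          P 0 0 * (M i 0 * (M⁻¹) 0 j) + P 0 1 * (M i 0 * (M⁻¹) 1 j) +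
          P 1 0 * (M i 1 * (M⁻¹) 0 j) + P 1 1 * (M i 1 * (M⁻¹) 1 j) + 0 := fun P => by
        simp only [Matrix.mul_apply, Fin.sum_univ_two]
        ring
      rw [meanP_apply, hsum]
      simp only [firstOrderP_eq T M, hsum]
      exact (integral_affine_comb (hi 0 0) (hi 0 1) (hi 1 0) (hi 1 1) _ _ _ _ _).2
    rw [h1, hM, Matrix.mul_assoc, ← Matrix.SpecialLinearGroup.coe_mul]
    simp
  · simp only [centeredPerturbation_pi_div_two, neg_eq_zero] at hnoise
    exact lyapunov_asymptotics_of_noise hT hA.firstOrder M μ hmean hnoise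
  · simp only [centeredPerturbation_zero] at hnoise
    obtain ⟨C, hC, ε, hε, h⟩ := lyapunov_asymptotics_of_noise hT hA.firstOrder (quarterTurn * M)
      (-μ) (meanP_quarterTurn hmean) (by simpa [firstOrderP_quarterTurn] using hnoise)
    refine ⟨C, hC, ε, hε, fun l hl hlμ => ?_⟩
    obtain ⟨γ, hγ, hb⟩ := h l hl (by linarith)
    exact ⟨γ, hγ, by simpa using hb⟩
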